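/- **Setting.** Let $\#\in\{D,N,R,T\}$ denote the Dirichlet, Neumann, Robin or transmission condition, let $\Omega\subset\mathbb R^2$ be open and let $\Omega^\#=\Omega$ if $\#\in\{D,N,R\}$, and $\Omega^\#=\Omega_-$, an open set with $\overline{\Omega_-}\subset\Omega$, if $\#=T$ (then $\Omega_+=\Omega\setminus\overline{\Omega_-}$). Let $V\in C^\infty(\overline\Omega;\mathbb R)$, and let $x^0\in\partial\Omega^\#$ be a point near which $\partial\Omega^\#$ is smooth. Near $x^0$ use the coordinates $(s,\rho)$, where $s$ is the arc length along $\partial\Omega^\#$ measured from $x^0$ and $\rho$ is the signed distance to $\partial\Omega^\#$, with $\rho>0$ in $\Omega$ if $\#\in\{D,N,R\}$, and $\rho<0$ in $\Omega_-$, $\rho>0$ in $\Omega_+$ if $\#=T$. Let $\mathfrak c(s)$ be the curvature of the boundary, so that $a(s,\rho)=1-\mathfrak c(s)\rho$ is the Jacobian, and let $v_{jk}=\frac1{j!\,k!}\,\partial_s^j\partial_\rho^kV(0,0)$. Assume $$v_{10}=0,\qquad v_{01}\neq0,\qquad v_{20}\neq 0 .$$ In the variables $(s,\rho)=(h^{1/2}\sigma,h^{2/3}\tau)$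 the operator $-h^2\Delta+iV$ reads $$\widehat{\mathcal A}_h=-h\,\widehat a_h^{-2}\partial_\sigma^2+h^{3/2}\,\widehat a_h^{-3}\widehat{(\partial_sa)}_h\,\partial_\sigma-h^{2/3}\partial_\tau^2-h^{4/3}\,\widehat a_h^{-1}\widehat{(\partial_\rho a)}_h\,\partial_\tau+i\widehat V_h,$$ where $\widehat g_h(\sigma,\tau)=g(h^{1/2}\sigma,h^{2/3}\tau)$. Taylor expansion of $V$ and $\mathfrak c$ at $0$ gives a formal expansion $$\widehat{\mathcal A}_h\sim iv_{00}+h^{2/3}\sum_{j\ge0}h^{j/6}\mathcal L_j ,$$ where the $\mathcal L_j$ are differential operators in $(\sigma,\tau)$ with polynomial coefficients; in particular $\mathcal L_0=-\partial_\tau^2+iv_{01}\tau$. The condition $\#$ at $\tau=0$ is, with $\kappa\ge 0$ independent of $h$: $u=0$ ($D$); $\partial_\tau u=0$ ($N$); $\partial_\tau u=\kappa u$ ($R$); $\partial_\tau u_-=\partial_\tau u_+=\kappa(u_+-u_-)$ ($T$). Let $\mathcal S^\#$ be $\mathcal S(\overline{\mathbb R_+})$ if $\#\in\{D,N,R\}$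 and $\mathcal S(\overline{\mathbb R_-})\times\mathcal S(\overline{\mathbb R_+})$ if $\#=T$, let $L^2_\#$ be $L^2(\mathbb R_+)$, respectively $L^2(\mathbb R_-)\times L^2(\mathbb R_+)$, and let $\mathcal L_0^\#$ be the realization of $\mathcal L_0$ in $L^2_\#$ with the condition $\#$, whose domain consists of the functions $u$ that are $H^2$ on each half-line, with $\tau u\in L^2_\#$, and satisfy the condition $\#$. **Proposition.** Let $(\lambda_j)_{j\ge0}$ be complex numbers and let $u_j\in\mathcal S(\mathbb R_\sigma)\otimes\mathcal S^\#$ (algebraic tensor product), $j\ge0$, satisfy the condition $\#$ at $\tau=0$, with $u_0\not\equiv0$, such that $$\lambda_h\sim iv_{00}+h^{2/3}\sum_{j\ge0}h^{j/6}\lambda_j,\qquad u_h\sim\sum_{j\ge0}h^{j/6}u_j$$ solve $(\widehat{\mathcal A}_h-\lambda_h)u_h\sim0$ formally in powers of $h^{1/6}$, that is, $$\sum_{i+k=j}(\mathcal L_i-\lambda_i)\,u_k=0\qquad\text{for all } j\ge0 .$$ Assume that $\lambda_0$ is a simple eigenvalue of $\mathcal L_0^\#$ (one-dimensional eigenspace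 and no Jordan block). Then $\lambda_j=0$ for every odd $j$. -/

import Mathlib

open scoped NNReal ContDiff SchwartzMap

noncomputable section

namespace BlochTorrey

/-- The Euclidean plane. -/
abbrev Plane : Type := EuclideanSpace ℝ (Fin 2)

/-- The boundary (or transmission) condition, with the rescaled Robin or transmission
parameter `κ ≥ 0`, which does not depend on the semiclassical parameter. -/
inductive BC : Type
  | dirichlet : BC
  | neumann : BC
  | robin (κ : ℝ≥0) : BC
  | transmission (κ : ℝ≥0) : BC

/-- The two sides of the boundary: `minus` is `ρ < 0` and `plus` is `ρ > 0`. -/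
inductive Side : Type
  | minus : Side
  | plus : Side

/-- The closed half-line of the normal variable that belongs to a side. -/
def Side.ray : Side → Set ℝ
  | .minus => Set.Iic 0
  | .plus => Set.Ici 0

/-- The sides on which the unknown function lives: only `ρ > 0` for the Dirichlet, Neumann and
Robin conditions, both sides for the transmission condition. All functions below are families
indexed by `Side`; only their restrictions to the rays of the sides in `bc.sides` matter. -/
def BC.sides : BC → Set Side
  | .transmission _ => Set.univ
  | _ => {Side.plus}

/-- The boundary condition, in terms of the one-sided boundary values and the one-sided normal
derivatives (in the direction of increasing `ρ`). -/
def BC.Holds : BC → (Side → ℂ) → (Side → ℂ) → Prop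
  | .dirichlet, val, _ => val .plus = 0
  | .neumann, _, der => der .plus = 0
  | .robin κ, val, der => der .plus = (κ : ℂ) * val .plus
  | .transmission κ, val, der =>
      der .minus = der .plus ∧ der .plus = (κ : ℂ) * (val .plus - val .minus)

/-! ### Geometry near the boundary point -/

/-- The relation between the whole domain `Ω` and the set `G` whose boundary carries the
condition: `G = Ω` for the Dirichlet, Neumann and Robin conditions; for the transmission
condition `G` is the inner component, the outer component being `Ω \ closure G`. -/
def BC.Compatible : BC → Set Plane → Set Plane → Prop
  | .transmission _, Ω, G => closure G ⊆ Ω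
  | _, Ω, G => G = Ω

/-- The local description of `G` in terms of the signed distance `ρ`: `G` is `ρ > 0` for one
component, and the inner component is `ρ < 0` for two components. -/
def BC.Inside : BC → ℝ → Prop
  | .transmission _, ρ => ρ < 0
  | _, ρ => 0 < ρ

/-- Curvilinear coordinates at the boundary point `x₀` of `G`: a smooth arc length
parametrisation `γ` of the boundary near `x₀ = γ 0`, and the unit normal field `N` along it that
points towards `ρ > 0`. The coordinates `(s, ρ)` stand for the point `γ s + ρ • N s`. -/
structure BoundaryFrame (bc : BC) (G : Set Plane) (x₀ : Plane) where
  γ : ℝ → Plane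
  N : ℝ → Plane
  ε : ℝ
  ε_pos : 0 < ε
  γ_smooth : ContDiffOn ℝ ∞ γ (Set.Ioo (-ε) ε)
  N_smooth : ContDiffOn ℝ ∞ N (Set.Ioo (-ε) ε)
  γ_zero : γ 0 = x₀
  arclength : ∀ s ∈ Set.Ioo (-ε) ε, ‖deriv γ s‖ = 1
  N_unit : ∀ s ∈ Set.Ioo (-ε) ε, ‖N s‖ = 1
  N_normal : ∀ s ∈ Set.Ioo (-ε) ε, inner ℝ (deriv γ s) (N s) = 0
  side : ∀ s ∈ Set.Ioo (-ε) ε, ∀ ρ ∈ Set.Ioo (-ε) ε, (γ s + ρ • N s ∈ G ↔ bc.Inside ρ)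

namespace BoundaryFrame

variable {bc : BC} {G : Set Plane} {x₀ : Plane}

/-- The curvature `𝔠(s)` of the boundary, `γ'' = 𝔠 N`; thus `|∂_s (γ + ρ N)| = 1 - 𝔠(s) ρ`. -/
def curvature (F : BoundaryFrame bc G x₀) (s : ℝ) : ℝ :=
  inner ℝ (iteratedDeriv 2 F.γ s) (F.N s)

/-- The derivative `𝔠^(ℓ)(0)`. -/
def c (F : BoundaryFrame bc G x₀) (l : ℕ) : ℝ := iteratedDeriv l F.curvature 0

/-- The Taylor coefficient `v_{jk} = (j! k!)⁻¹ ∂_s^j ∂_ρ^k V(s, ρ)` at `s = ρ = 0`. The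
`ρ`-derivatives are taken from `ρ ≥ 0`, where `V` is defined for every boundary condition. -/
def v (F : BoundaryFrame bc G x₀) (V : Plane → ℝ) (j k : ℕ) : ℝ :=
  iteratedDeriv j
      (fun s : ℝ => iteratedDerivWithin k (fun ρ : ℝ => V (F.γ s + ρ • F.N s)) (Set.Ici 0) 0) 0
    / ((j.factorial : ℝ) * (k.factorial : ℝ))

/-! ### The formal operator

The formal variable `X` stands for `h^(1/6)`, and `s = h^(1/2) σ = X^3 σ`,
`ρ = h^(2/3) τ = X^4 τ`. All series are taken at a fixed point `(σ, τ)`. -/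

/-- The Taylor series of `𝔠(h^(1/2) σ)`. -/
def cSeries (F : BoundaryFrame bc G x₀) (σ : ℝ) : PowerSeries ℂ :=
  PowerSeries.mk fun n =>
    if 3 ∣ n then ((F.c (n / 3) / ((n / 3).factorial : ℝ) * σ ^ (n / 3) : ℝ) : ℂ) else 0

/-- The Taylor series of `𝔠'(h^(1/2) σ)`. -/
def cDerivSeries (F : BoundaryFrame bc G x₀) (σ : ℝ) : PowerSeries ℂ :=
  PowerSeries.mk fun n =>
    if 3 ∣ n then ((F.c (n / 3 + 1) / ((n / 3).factorial : ℝ) * σ ^ (n / 3) : ℝ) : ℂ) else 0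

/-- The expansion of `a = 1 - 𝔠(s) ρ`. -/
def aSeries (F : BoundaryFrame bc G x₀) (σ τ : ℝ) : PowerSeries ℂ :=
  1 - PowerSeries.X ^ 4 * PowerSeries.C (τ : ℂ) * F.cSeries σ

/-- The expansion of `∂_s a = - 𝔠'(s) ρ`. -/
def asSeries (F : BoundaryFrame bc G x₀) (σ τ : ℝ) : PowerSeries ℂ :=
  -(PowerSeries.X ^ 4 * PowerSeries.C (τ : ℂ) * F.cDerivSeries σ)

/-- The expansion of `∂_ρ a = - 𝔠(s)`. -/
def aρSeries (F : BoundaryFrame bc G x₀) (σ : ℝ) : PowerSeries ℂ :=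
  -F.cSeries σ

/-- The expansion of `V(h^(1/2) σ, h^(2/3) τ)`: the coefficient of `h^(m/6)` is the sum of
`v_{kp} σ^k τ^p` over `3 k + 4 p = m`. -/
def VSeries (F : BoundaryFrame bc G x₀) (V : Plane → ℝ) (σ τ : ℝ) : PowerSeries ℂ :=
  PowerSeries.mk fun m =>
    ∑ k ∈ Finset.range (m + 1), ∑ p ∈ Finset.range (m + 1),
      if 3 * k + 4 * p = m then ((F.v V k p * σ ^ k * τ ^ p : ℝ) : ℂ) else 0

/-- The expansion of `h^(-2/3) (V(h^(1/2) σ, h^(2/3) τ) - v₀₀)`, when `v₁₀ = 0`. -/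
def VShiftSeries (F : BoundaryFrame bc G x₀) (V : Plane → ℝ) (σ τ : ℝ) : PowerSeries ℂ :=
  PowerSeries.mk fun m => PowerSeries.coeff (m + 4) (F.VSeries V σ τ)

/-- The expansion of `h^(-2/3) (Â_h - i v₀₀) f` at the point `(σ, τ)`, where
`Â_h = - h a⁻² ∂_σ² + h^(3/2) a⁻³ (∂_s a) ∂_σ - h^(2/3) ∂_τ² - h^(4/3) a⁻¹ (∂_ρ a) ∂_τ + i V` is the
operator `- h² Δ + i V` in the coordinates `(σ, τ)`. -/
def opSeries (F : BoundaryFrame bc G x₀) (V : Plane → ℝ) (f : ℝ → ℝ → ℂ) (σ τ : ℝ) :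
    PowerSeries ℂ :=
  -PowerSeries.C (iteratedDeriv 2 (fun t => f σ t) τ)
    - PowerSeries.X ^ 2 * (F.aSeries σ τ)⁻¹ ^ 2
        * PowerSeries.C (iteratedDeriv 2 (fun s => f s τ) σ)
    - PowerSeries.X ^ 4 * (F.aSeries σ τ)⁻¹ * F.aρSeries σ
        * PowerSeries.C (deriv (fun t => f σ t) τ)
    + PowerSeries.X ^ 5 * (F.aSeries σ τ)⁻¹ ^ 3 * F.asSeries σ τ
        * PowerSeries.C (deriv (fun s => f s τ) σ)
    + PowerSeries.C Complex.I * F.VShiftSeries V σ τ * PowerSeries.C (f σ τ)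

/-- The differential operator `𝓛_j`, the coefficient of `h^(j/6)` in `h^(-2/3) (Â_h - i v₀₀)`. -/
def L (F : BoundaryFrame bc G x₀) (V : Plane → ℝ) (j : ℕ) (f : ℝ → ℝ → ℂ) (σ τ : ℝ) : ℂ :=
  PowerSeries.coeff j (F.opSeries V f σ τ)

end BoundaryFrame

/-! ### The complex Airy operator -/

/-- `f` belongs to the Sobolev space `H²` of the closed half-line `I` with end point `0`, with
derivatives `f₁` and `f₂`. -/
structure IsH2On (I : Set ℝ) (f f₁ f₂ : ℝ → ℂ) : Prop where
  memLp : MeasureTheory.MemLp f 2 (MeasureTheory.volume.restrict I)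
  memLp₁ : MeasureTheory.MemLp f₁ 2 (MeasureTheory.volume.restrict I)
  memLp₂ : MeasureTheory.MemLp f₂ 2 (MeasureTheory.volume.restrict I)
  eq_integral : ∀ t ∈ I, f t = f 0 + ∫ x in (0 : ℝ)..t, f₁ x
  eq_integral₁ : ∀ t ∈ I, f₁ t = f₁ 0 + ∫ x in (0 : ℝ)..t, f₂ x

/-- `f` is in the domain of the realization in `L²` of `𝓛₀ = - ∂_τ² + i v τ` with the boundary
condition `bc`, and `𝓛₀ f = g`. The domain consists of the functions in `H²` (on each side) with
`τ f` in `L²` that satisfy the boundary condition. -/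
def AiryGraph (bc : BC) (v : ℝ) (f g : Side → ℝ → ℂ) : Prop :=
  ∃ f₁ f₂ : Side → ℝ → ℂ,
    (∀ a ∈ bc.sides,
      IsH2On a.ray (f a) (f₁ a) (f₂ a) ∧
      MeasureTheory.MemLp (fun τ : ℝ => (τ : ℂ) * f a τ) 2
        (MeasureTheory.volume.restrict a.ray) ∧
      ∀ᵐ τ ∂(MeasureTheory.volume.restrict a.ray),
        -f₂ a τ + Complex.I * (v : ℂ) * (τ : ℂ) * f a τ = g a τ) ∧
    bc.Holds (fun a => f a 0) (fun a => f₁ a 0)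

/-- `μ` is a simple eigenvalue of the realization of `- ∂_τ² + i v τ`: the eigenspace is spanned
by one eigenfunction, and there is no Jordan block. -/
def IsSimpleAiryEigenvalue (bc : BC) (v : ℝ) (μ : ℂ) : Prop :=
  ∃ ψ : Side → ℝ → ℂ,
    (∃ a ∈ bc.sides, ∃ τ ∈ a.ray, ψ a τ ≠ 0) ∧
    AiryGraph bc v ψ (fun a τ => μ * ψ a τ) ∧
    (∀ χ : Side → ℝ → ℂ, AiryGraph bc v χ (fun a τ => μ * χ a τ) →
      ∃ z : ℂ, ∀ a ∈ bc.sides, ∀ τ ∈ a.ray, χ a τ = z * ψ a τ) ∧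
    ¬ ∃ χ : Side → ℝ → ℂ, AiryGraph bc v χ (fun a τ => μ * χ a τ + ψ a τ)

/-! ### Formal expansions -/

/-- Finite sums of products `φ(σ) ψ(τ)` of Schwartz functions. Restricting `τ` to a closed
half-line gives the algebraic tensor product of the Schwartz space of the line and the Schwartz
space of the closed half-line (restrictions of Schwartz functions of the line). -/
def tensorSchwartz : Submodule ℂ (ℝ → ℝ → ℂ) :=
  Submodule.span ℂ {f | ∃ φ ψ : 𝓢(ℝ, ℂ), f = fun σ τ => φ σ * ψ τ}

/-- `(i v₀₀ + h^(2/3) ∑ h^(j/6) lam j, ∑ h^(j/6) u j)` is a formal eigenpair of `Â_h`, with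
nonzero leading term `u 0`: the `u j` satisfy the boundary condition, and each power of `h^(1/6)`
in the eigenvalue equation cancels. -/
structure IsFormalExpansion {bc : BC} {G : Set Plane} {x₀ : Plane} (F : BoundaryFrame bc G x₀)
    (V : Plane → ℝ) (lam : ℕ → ℂ) (u : ℕ → Side → ℝ → ℝ → ℂ) : Prop where
  mem : ∀ j, ∀ a ∈ bc.sides, u j a ∈ tensorSchwartz
  boundary : ∀ j σ, bc.Holds (fun a => u j a σ 0) (fun a => deriv (fun τ => u j a σ τ) 0)
  ne_zero : ∃ a ∈ bc.sides, ∃ σ, ∃ τ ∈ a.ray, u 0 a σ τ ≠ 0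
  equation : ∀ j, ∀ a ∈ bc.sides, ∀ σ, ∀ τ ∈ a.ray,
    ∑ p ∈ Finset.HasAntidiagonal.antidiagonal j,
      (F.L V p.1 (u p.2 a) σ τ - lam p.1 * u p.2 a σ τ) = 0

end BlochTorrey

end

noncomputable section

namespace BlochTorrey

open MeasureTheory Filter Topology PowerSeries

/-! Write `X` for h^(1/6), so that s = X³σ and ρ = X⁴τ. A Taylor monomial σ^k τ^p carries the weight
3k + 4p, which has the parity of k, and the formal operator is therefore invariant under (X, σ) ↦
(-X, -σ) (`rescale_opJet`). Hence a formal eigenpair (λ(X), U(X; σ, τ)) has a reflected partner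
(λ(-X), W) with W = U(-X; -σ, τ).

Multiplied by the Jacobian `a`, the operator takes divergence form. It is thus symmetric for the
bilinear pairing ∫∫ a f g, without conjugation, and the boundary condition is symmetric as well.
Green's formula (`BoundaryFrame.green`, `BC.Holds.wronskian`) gives (λ(X) - λ(-X)) ∫∫ a U W = 0 in
ℂ[[X]]. This ring is a domain, so it is enough that the constant term ∫∫ u₀(σ, τ) u₀(-σ, τ) of the
second factor does not vanish.

The equations of orders 0, 1, 2 give u₀ = φ(σ) g(τ), with φ an eigenfunction of the complex harmonic
oscillator and g one of the Airy operator (`IsFormalExpansion.leading`), so the constant term is ∫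
φ(σ) φ(-σ) times ∫ g². The first factor is nonzero by descent with a lowering operator, which shows
that φ has a parity and that ∫ φ² ≠ 0 (`harmonic_eigenfunction`). The second is nonzero because ∫ g²
= 0 would allow an explicit Jordan chain built from g' and g
(`AirySolution.total_integral_sq_ne_zero`). -/

/-! ### Operations on Schwartz functions of one variable -/

/-- The derivative of a Schwartz function. -/
def schwartzD (f : 𝓢(ℝ, ℂ)) : 𝓢(ℝ, ℂ) := SchwartzMap.derivCLM ℂ ℂ f

/-- The pointwise product of two Schwartz functions. -/
def schwartzMul (f g : 𝓢(ℝ, ℂ)) : 𝓢(ℝ, ℂ) :=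
  SchwartzMap.pairing (ContinuousLinearMap.mul ℂ ℂ) f g

/-- Multiplication of a Schwartz function by the coordinate. -/
def schwartzCoord (f : 𝓢(ℝ, ℂ)) : 𝓢(ℝ, ℂ) :=
  SchwartzMap.smulLeftCLM ℂ (fun x : ℝ => (x : ℂ)) f

/-- The reflection of a Schwartz function. -/
def schwartzReflect (f : 𝓢(ℝ, ℂ)) : 𝓢(ℝ, ℂ) :=
  SchwartzMap.compCLMOfContinuousLinearEquiv ℂ (ContinuousLinearEquiv.neg ℝ) f

/-- The complex conjugate of a Schwartz function. -/
def schwartzConj (f : 𝓢(ℝ, ℂ)) : 𝓢(ℝ, ℂ) :=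
  f.postcompCLM (Complex.conjCLE : ℂ →L[ℝ] ℂ)

theorem hasDerivAt_schwartzD (f : 𝓢(ℝ, ℂ)) (x : ℝ) : HasDerivAt f (schwartzD f x) x :=
  f.hasDerivAt x

@[simp] theorem deriv_schwartz (f : 𝓢(ℝ, ℂ)) (x : ℝ) : deriv f x = schwartzD f x := rfl

@[simp] theorem schwartzMul_apply (f g : 𝓢(ℝ, ℂ)) (x : ℝ) : schwartzMul f g x = f x * g x := rfl

@[simp] theorem schwartzCoord_apply (f : 𝓢(ℝ, ℂ)) (x : ℝ) : schwartzCoord f x = x * f x := by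
  have h : Function.HasTemperateGrowth (fun x : ℝ => (x : ℂ)) :=
    Complex.ofRealCLM.hasTemperateGrowth
  simp [schwartzCoord, SchwartzMap.smulLeftCLM_apply_apply h]

@[simp] theorem schwartzConj_apply (f : 𝓢(ℝ, ℂ)) (x : ℝ) :
    schwartzConj f x = starRingEnd ℂ (f x) := rfl

theorem schwartz_tendsto_atTop (f : 𝓢(ℝ, ℂ)) : Tendsto f atTop (𝓝 0) :=
  f.tendsto_cocompact.mono_left atTop_le_cocompact

theorem schwartz_tendsto_atBot (f : 𝓢(ℝ, ℂ)) : Tendsto f atBot (𝓝 0) :=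
  f.tendsto_cocompact.mono_left atBot_le_cocompact

theorem integral_schwartzD (f : 𝓢(ℝ, ℂ)) : ∫ x, schwartzD f x = 0 := by
  simpa using integral_of_hasDerivAt_of_tendsto (hasDerivAt_schwartzD f)
    (schwartzD f).integrable (schwartz_tendsto_atBot f) (schwartz_tendsto_atTop f)

/-- The sign of the outward derivative at the boundary of a side. -/
def Side.sign : Side → ℂ
  | .minus => 1
  | .plus => -1

theorem integral_ray_schwartzD (a : Side) (f : 𝓢(ℝ, ℂ)) :
    ∫ x in a.ray, schwartzD f x = a.sign * f 0 := by
  cases a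
  · have := integral_Iic_of_hasDerivAt_of_tendsto' (a := (0 : ℝ))
      (fun x _ => hasDerivAt_schwartzD f x) (schwartzD f).integrable.integrableOn
      (schwartz_tendsto_atBot f)
    simpa [Side.ray, Side.sign] using this
  · have := integral_Ioi_of_hasDerivAt_of_tendsto' (a := (0 : ℝ))
      (fun x _ => hasDerivAt_schwartzD f x) (schwartzD f).integrable.integrableOn
      (schwartz_tendsto_atTop f)
    rw [Side.ray, integral_Ici_eq_integral_Ioi, this]
    simp [Side.sign]

theorem Side.measurableSet_ray (a : Side) : MeasurableSet a.ray := by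
  cases a
  · exact measurableSet_Iic
  · exact measurableSet_Ici

theorem Side.uniqueDiffOn_ray (a : Side) : UniqueDiffOn ℝ a.ray := by
  cases a
  · exact uniqueDiffOn_Iic 0
  · exact uniqueDiffOn_Ici 0

theorem Side.zero_mem_ray (a : Side) : (0 : ℝ) ∈ a.ray := by
  cases a <;> simp [Side.ray]

/-! ### The complex harmonic oscillator -/

/-- Energy identity: since w² is purely imaginary, the real part of (φ̄ φ')' is |φ'|² - Re l |φ|², a
sum of nonnegative terms with integral zero. This starts the descent on eigenvalues. -/
theorem harmonic_nonneg_re {w l : ℂ} (hw : (w ^ 2).re = 0) {φ : 𝓢(ℝ, ℂ)}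
    (h : ∀ x, schwartzD (schwartzD φ) x = (w ^ 2 * x ^ 2 - l) * φ x)
    (hl : l.re < 0) (x : ℝ) : φ x = 0 := by
  set F := schwartzMul (schwartzConj φ) (schwartzD φ) with hF
  have hd (x : ℝ) : (schwartzD F x).re = ‖schwartzD φ x‖ ^ 2 - l.re * ‖φ x‖ ^ 2 := by
    have h1 : HasDerivAt (schwartzConj φ) (starRingEnd ℂ (schwartzD φ x)) x :=
      (Complex.conjCLE : ℂ →L[ℝ] ℂ).hasFDerivAt.comp_hasDerivAt x (hasDerivAt_schwartzD φ x)
    have h2 := h1.mul (hasDerivAt_schwartzD (schwartzD φ) x)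
    have h3 : schwartzD F x = _ := (hasDerivAt_schwartzD F x).unique h2
    have hx : (w ^ 2 * (x : ℂ) ^ 2).re = 0 := by
      rw [← Complex.ofReal_pow, Complex.re_mul_ofReal, hw, zero_mul]
    rw [h3, h, schwartzConj_apply, mul_left_comm, ← Complex.normSq_eq_conj_mul_self,
      ← Complex.normSq_eq_conj_mul_self, Complex.add_re, Complex.ofReal_re,
      Complex.re_mul_ofReal, Complex.sub_re, hx, Complex.normSq_eq_norm_sq,
      Complex.normSq_eq_norm_sq]
    ring
  have hint : ∫ x, (schwartzD F x).re = 0 := by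
    have := integral_re (schwartzD F).integrable (𝕜 := ℂ) (μ := volume)
    simp only [RCLike.re_to_complex] at this
    rw [this, integral_schwartzD, Complex.zero_re]
  have hnn : 0 ≤ fun x => (schwartzD F x).re := fun x => by
    simp only [hd, Pi.zero_apply]
    nlinarith [sq_nonneg ‖schwartzD φ x‖, sq_nonneg ‖φ x‖]
  have h0 := (integral_eq_zero_iff_of_nonneg hnn (schwartzD F).integrable.re).1 hint
  have h1 := (Complex.continuous_re.comp (schwartzD F).continuous).ae_eq_iff_eq
    (μ := volume) continuous_const |>.1 h0
  have h2 : ‖schwartzD φ x‖ ^ 2 - l.re * ‖φ x‖ ^ 2 = 0 := by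
    rw [← hd]; exact congrFun h1 x
  have h3 : ‖φ x‖ ^ 2 = 0 := by nlinarith [sq_nonneg ‖schwartzD φ x‖, sq_nonneg ‖φ x‖]
  simpa using h3

/-- The lowering operator `∂ + w x`. -/
def lowering (w : ℂ) (φ : 𝓢(ℝ, ℂ)) : 𝓢(ℝ, ℂ) := schwartzD φ + w • schwartzCoord φ

@[simp] theorem lowering_apply (w : ℂ) (φ : 𝓢(ℝ, ℂ)) (x : ℝ) :
    lowering w φ x = schwartzD φ x + w * (x * φ x) := by
  simp [lowering]

theorem hasDerivAt_ofReal (x : ℝ) : HasDerivAt (fun x : ℝ => (x : ℂ)) 1 x :=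
  (hasDerivAt_id x).ofReal_comp

/-- The factorisation (∂ - wx)(∂ + wx) = ∂² - w²x² + w: the raising operator recovers (w - l) φ from
the lowered function. -/
theorem hasDerivAt_lowering {w l : ℂ} {φ : 𝓢(ℝ, ℂ)}
    (h : ∀ x, schwartzD (schwartzD φ) x = (w ^ 2 * x ^ 2 - l) * φ x) (x : ℝ) :
    HasDerivAt (lowering w φ) (w * x * lowering w φ x + (w - l) * φ x) x := by
  have h1 : HasDerivAt (fun x => schwartzD φ x + w * (x * φ x)) _ x :=
    (hasDerivAt_schwartzD (schwartzD φ) x).add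
      (((hasDerivAt_ofReal x).mul (hasDerivAt_schwartzD φ x)).const_mul w)
  have h2 : (lowering w φ : ℝ → ℂ) = fun x => schwartzD φ x + w * (x * φ x) := by
    ext; simp
  rw [h2]
  convert h1 using 1
  rw [h]; ring

theorem schwartzD_lowering {w l : ℂ} {φ : 𝓢(ℝ, ℂ)}
    (h : ∀ x, schwartzD (schwartzD φ) x = (w ^ 2 * x ^ 2 - l) * φ x) (x : ℝ) :
    schwartzD (lowering w φ) x = w * x * lowering w φ x + (w - l) * φ x :=
  (hasDerivAt_schwartzD _ x).unique (hasDerivAt_lowering h x)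

/-- Each lowering subtracts 2w from the eigenvalue. As Re w > 0 in the application, finitely many
lowerings make its real part negative. -/
theorem lowering_harmonic {w l : ℂ} {φ : 𝓢(ℝ, ℂ)}
    (h : ∀ x, schwartzD (schwartzD φ) x = (w ^ 2 * x ^ 2 - l) * φ x) (x : ℝ) :
    schwartzD (schwartzD (lowering w φ)) x = (w ^ 2 * x ^ 2 - (l - 2 * w)) * lowering w φ x := by
  have h1 := (((hasDerivAt_ofReal x).const_mul w).mul (hasDerivAt_lowering h x)).add
    ((hasDerivAt_schwartzD φ x).const_mul (w - l))
  have h2 : (schwartzD (lowering w φ) : ℝ → ℂ)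
      = fun x : ℝ => w * x * lowering w φ x + (w - l) * φ x := funext (schwartzD_lowering h)
  have h4 := hasDerivAt_schwartzD (schwartzD (lowering w φ)) x
  rw [h2] at h4
  have h3 := h4.unique h1
  rw [h3]
  simp only [lowering_apply]; ring

/-- With A = ∂ + wx, the product rule and the factorisation give (Aφ)² = (φ Aφ)' + (l - w) φ². -/
theorem integral_lowering_sq {w l : ℂ} {φ : 𝓢(ℝ, ℂ)}
    (h : ∀ x, schwartzD (schwartzD φ) x = (w ^ 2 * x ^ 2 - l) * φ x) :
    ∫ x, lowering w φ x ^ 2 = (l - w) * ∫ x, φ x ^ 2 := by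
  set F := schwartzMul φ (lowering w φ) with hF
  have hd (x : ℝ) : lowering w φ x ^ 2 = schwartzD F x + (l - w) * φ x ^ 2 := by
    have h3 : schwartzD F x = _ := (hasDerivAt_schwartzD F x).unique
      ((hasDerivAt_schwartzD φ x).mul (hasDerivAt_lowering h x))
    rw [h3]; simp only [lowering_apply]; ring
  simp_rw [hd]
  have hi : Integrable (fun x => φ x ^ 2) := by
    simp only [sq]
    exact (schwartzMul φ φ).integrable (μ := volume)
  rw [integral_add (schwartzD F).integrable (hi.const_mul _), integral_schwartzD,
    integral_const_mul, zero_add]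

theorem eq_gaussian_of_lowering_eq_zero {w : ℂ} {φ : 𝓢(ℝ, ℂ)}
    (h : ∀ x, lowering w φ x = 0) (x : ℝ) : φ x = φ 0 * Complex.exp (-(w / 2) * x ^ 2) := by
  have hE (x : ℝ) : HasDerivAt (fun x : ℝ => Complex.exp (w / 2 * x ^ 2))
      (Complex.exp (w / 2 * x ^ 2) * (w * x)) x := by
    have h1 := (((hasDerivAt_ofReal x).mul (hasDerivAt_ofReal x)).const_mul (w / 2)).cexp
    simp only [Pi.mul_apply, ← sq] at h1
    exact h1.congr_deriv (by ring)
  have hG (x : ℝ) : HasDerivAt (fun x : ℝ => φ x * Complex.exp (w / 2 * x ^ 2)) 0 x := by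
    have := h x
    rw [lowering_apply] at this
    refine ((hasDerivAt_schwartzD φ x).mul (hE x)).congr_deriv ?_
    linear_combination Complex.exp (w / 2 * x ^ 2) * this
  have := is_const_of_deriv_eq_zero (fun x => (hG x).differentiableAt)
    (fun x => (hG x).deriv) x 0
  simp only [Complex.ofReal_zero] at this
  have h2 : φ x * Complex.exp (w / 2 * x ^ 2) = φ 0 := by simpa using this
  rw [← h2, mul_assoc, ← Complex.exp_add]
  simp

/-- Induction on the number of lowerings. Either φ is killed by the lowering operator and is a
Gaussian, or the lowered function is an eigenfunction to which the induction hypothesis applies. -/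
theorem harmonic_eigenfunction {w : ℂ} (hw : 0 < w.re) (hw2 : (w ^ 2).re = 0) (n : ℕ) :
    ∀ (φ : 𝓢(ℝ, ℂ)) (l : ℂ), l.re < 2 * n * w.re →
      (∀ x, schwartzD (schwartzD φ) x = (w ^ 2 * x ^ 2 - l) * φ x) → (∃ x, φ x ≠ 0) →
      (∃ ε : ℂ, ε ≠ 0 ∧ ∀ x, φ (-x) = ε * φ x) ∧ ∫ x, φ x ^ 2 ≠ 0 := by
  induction n with
  | zero =>
    rintro φ l hl h ⟨x, hx⟩
    exact absurd (harmonic_nonneg_re hw2 h (by simpa using hl) x) hx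
  | succ n ih =>
    rintro φ l hl h ⟨x, hx⟩
    by_cases ha : ∀ y, lowering w φ y = 0
    · have hφ := eq_gaussian_of_lowering_eq_zero ha
      have h0 : φ 0 ≠ 0 := fun h0 => hx (by rw [hφ, h0, zero_mul])
      refine ⟨⟨1, one_ne_zero, fun y => ?_⟩, ?_⟩
      · rw [hφ (-y), hφ y]; simp
      · have he : (fun x => φ x ^ 2) = fun x : ℝ => φ 0 ^ 2 * Complex.exp (-w * x ^ 2) := by
          ext y
          rw [hφ y, mul_pow, ← Complex.exp_nat_mul]
          congr 2; push_cast; ring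
        rw [he, integral_const_mul, integral_gaussian_complex hw]
        have hw0 : w ≠ 0 := fun h => by simp [h] at hw
        refine mul_ne_zero (pow_ne_zero _ h0) ?_
        rw [Complex.cpow_ne_zero_iff]
        left
        exact div_ne_zero (by exact_mod_cast Real.pi_ne_zero) hw0
    · push Not at ha
      have hl' : (l - 2 * w).re < 2 * n * w.re := by
        have : (2 * w).re = 2 * w.re := by simp
        rw [Complex.sub_re, this]
        push_cast at hl
        linarith
      obtain ⟨⟨ε, hε, hp⟩, hi⟩ := ih _ _ hl' (lowering_harmonic h) ha
      rw [integral_lowering_sq h] at hi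
      -- The two conclusions are proved together because the nonzero integral of the lowered
      -- function excludes l = w, which allows φ to be recovered from it.
      have hlw : l - w ≠ 0 := left_ne_zero_of_mul hi
      refine ⟨⟨-ε, neg_ne_zero.2 hε, fun y => ?_⟩, right_ne_zero_of_mul hi⟩
      have hD (z : ℝ) : schwartzD (lowering w φ) (-z) = -(ε * schwartzD (lowering w φ) z) := by
        have h1 : HasDerivAt (fun z => lowering w φ (-z)) (-schwartzD (lowering w φ) (-z)) z := by
          exact ((hasDerivAt_schwartzD (lowering w φ) (-z)).scomp z
            (hasDerivAt_neg z)).congr_deriv (by simp)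
        have h2 := (hasDerivAt_schwartzD (lowering w φ) z).const_mul ε
        rw [funext hp] at h1
        rw [← h1.unique h2, neg_neg]
      have e1 := schwartzD_lowering h y
      have e2 := schwartzD_lowering h (-y)
      rw [hD, hp] at e2
      push_cast at e2
      -- The raising operator ∂ - wx is odd, so it reverses parity.
      have : (l - w) * φ (-y) = (l - w) * (-ε * φ y) := by
        linear_combination ε * e1 + e2
      exact mul_left_cancel₀ hlw this

/-- The root in the right half-plane is the one whose Gaussian exp(-wx²/2) decays. -/
theorem exists_sq_eq_I_mul {v : ℝ} (hv : v ≠ 0) : ∃ w : ℂ, 0 < w.re ∧ w ^ 2 = Complex.I * v := by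
  have hs : 0 < √(|v| / 2) := Real.sqrt_pos.2 (by positivity)
  have hq : √(|v| / 2) * √(|v| / 2) = |v| / 2 := Real.mul_self_sqrt (by positivity)
  rcases lt_or_gt_of_ne hv with h | h
  · refine ⟨⟨√(|v| / 2), -√(|v| / 2)⟩, hs, ?_⟩
    rw [abs_of_neg h] at hq ⊢
    apply Complex.ext
    · simp [sq]
    · simp only [sq, Complex.mul_im, Complex.I_im, Complex.I_re, Complex.ofReal_re,
        Complex.ofReal_im]
      linarith
  · refine ⟨⟨√(|v| / 2), √(|v| / 2)⟩, hs, ?_⟩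
    rw [abs_of_pos h] at hq ⊢
    apply Complex.ext
    · simp [sq]
    · simp only [sq, Complex.mul_im, Complex.I_im, Complex.I_re, Complex.ofReal_re,
        Complex.ofReal_im]
      linarith

/-- An eigenfunction of the complex harmonic oscillator is not orthogonal, for the bilinear
pairing, to its reflection. -/
theorem integral_mul_reflect_ne_zero {v : ℝ} (hv : v ≠ 0) {φ : 𝓢(ℝ, ℂ)} {l : ℂ}
    (h : ∀ x : ℝ, schwartzD (schwartzD φ) x = (Complex.I * v * x ^ 2 - l) * φ x)
    (hφ : ∃ x, φ x ≠ 0) : ∫ x, φ x * φ (-x) ≠ 0 := by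
  obtain ⟨w, hw, hw2⟩ := exists_sq_eq_I_mul hv
  obtain ⟨n, hn⟩ := exists_nat_gt (l.re / (2 * w.re))
  rw [← hw2] at h
  have hn' : l.re < 2 * n * w.re := by
    rw [div_lt_iff₀ (by positivity)] at hn
    linarith
  obtain ⟨⟨ε, hε, hp⟩, hi⟩ := harmonic_eigenfunction hw (by simp [hw2]) n φ l hn' h hφ
  have : (fun x => φ x * φ (-x)) = fun x => ε * φ x ^ 2 := by
    ext x; rw [hp]; ring
  rw [this, integral_const_mul]
  exact mul_ne_zero hε hi

/-! ### Boundary conditions -/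

/-- The sum over the sides on which the unknown function lives. -/
def BC.total : BC → (Side → ℂ) →ₗ[ℂ] ℂ
  | .transmission _ => (LinearMap.proj Side.minus : (Side → ℂ) →ₗ[ℂ] ℂ) + LinearMap.proj Side.plus
  | _ => (LinearMap.proj Side.plus : (Side → ℂ) →ₗ[ℂ] ℂ)

theorem BC.total_congr {bc : BC} {x y : Side → ℂ} (h : ∀ a ∈ bc.sides, x a = y a) :
    bc.total x = bc.total y := by
  cases bc <;> simp_all [BC.total, BC.sides]

theorem BC.Holds.congr {bc : BC} {x x' y y' : Side → ℂ} (h : bc.Holds x x')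
    (h₀ : ∀ a ∈ bc.sides, x a = y a) (h₁ : ∀ a ∈ bc.sides, x' a = y' a) : bc.Holds y y' := by
  cases bc <;> simp_all [BC.Holds, BC.sides]

theorem BC.Holds.const_mul {bc : BC} {x x' : Side → ℂ} (h : bc.Holds x x') (c : ℂ) :
    bc.Holds (fun a => c * x a) (fun a => c * x' a) := by
  cases bc
  · simp_all [BC.Holds]
  · simp_all [BC.Holds]
  · simp only [BC.Holds] at h ⊢
    rw [h]; ring
  · simp only [BC.Holds] at h ⊢
    refine ⟨by rw [h.1], by rw [h.2]; ring⟩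

/-- Bilinear symmetry of the boundary condition: this is what cancels the boundary terms of Green's
formula. For the transmission condition only the sum over the two sides cancels. -/
theorem BC.Holds.wronskian {bc : BC} {x x' y y' : Side → ℂ} (hx : bc.Holds x x')
    (hy : bc.Holds y y') : bc.total (fun a => a.sign * (y a * x' a - x a * y' a)) = 0 := by
  cases bc
  · simp_all [BC.Holds, BC.total]
  · simp_all [BC.Holds, BC.total]
  · simp only [BC.Holds] at hx hy
    simp only [BC.total, LinearMap.proj_apply, hx, hy]; ring
  · simp only [BC.Holds] at hx hy
    simp only [BC.total, LinearMap.add_apply, LinearMap.proj_apply, hx, hy, Side.sign]; ring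

/-! ### The complex Airy operator on Schwartz functions -/

/-- The family `f` satisfies the boundary condition and `(- ∂_τ² + i v τ - μ) f = r`. -/
def AirySolution (bc : BC) (v : ℝ) (μ : ℂ) (f : Side → 𝓢(ℝ, ℂ)) (r : Side → ℝ → ℂ) : Prop :=
  (∀ a ∈ bc.sides, ∀ τ ∈ a.ray,
    -schwartzD (schwartzD (f a)) τ + Complex.I * v * τ * f a τ = μ * f a τ + r a τ) ∧
  bc.Holds (fun a => f a 0) (fun a => schwartzD (f a) 0)

theorem schwartz_eq_integral (f : 𝓢(ℝ, ℂ)) (t : ℝ) :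
    f t = f 0 + ∫ x in (0 : ℝ)..t, schwartzD f x := by
  rw [intervalIntegral.integral_eq_sub_of_hasDerivAt (fun x _ => hasDerivAt_schwartzD f x)
    ((schwartzD f).continuous.intervalIntegrable _ _)]
  ring

theorem AirySolution.airyGraph {bc : BC} {v : ℝ} {μ : ℂ} {f : Side → 𝓢(ℝ, ℂ)}
    {r : Side → ℝ → ℂ} (h : AirySolution bc v μ f r) :
    AiryGraph bc v (fun a => f a) (fun a τ => μ * f a τ + r a τ) := by
  refine ⟨fun a => schwartzD (f a), fun a => schwartzD (schwartzD (f a)), fun a ha => ?_, h.2⟩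
  refine ⟨⟨((f a).memLp 2).restrict _, ((schwartzD (f a)).memLp 2).restrict _,
    ((schwartzD (schwartzD (f a))).memLp 2).restrict _, fun t _ => schwartz_eq_integral _ t,
    fun t _ => schwartz_eq_integral _ t⟩, ?_, ?_⟩
  · have := ((schwartzCoord (f a)).memLp 2).restrict a.ray
    rwa [funext (schwartzCoord_apply (f a))] at this
  · exact (ae_restrict_iff' a.measurableSet_ray).2 (Eventually.of_forall (h.1 a ha))

@[simp] theorem schwartzD_smul (c : ℂ) (f : 𝓢(ℝ, ℂ)) : schwartzD (c • f) = c • schwartzD f := by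
  simp [schwartzD]

@[simp] theorem schwartzD_add (f g : 𝓢(ℝ, ℂ)) :
    schwartzD (f + g) = schwartzD f + schwartzD g := by
  simp [schwartzD]

@[simp] theorem schwartzD_zero : schwartzD 0 = 0 := by
  simp [schwartzD]

theorem AirySolution.const_smul {bc : BC} {v : ℝ} {μ : ℂ} {f : Side → 𝓢(ℝ, ℂ)}
    {r : Side → ℝ → ℂ} (h : AirySolution bc v μ f r) (c : ℂ) :
    AirySolution bc v μ (fun a => c • f a) (fun a τ => c * r a τ) := by
  refine ⟨fun a ha τ hτ => ?_, ?_⟩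
  · simp only [schwartzD_smul, smul_apply, smul_eq_mul]
    linear_combination c * h.1 a ha τ hτ
  · simpa using h.2.const_mul c

theorem AirySolution.eq_const_mul {bc : BC} {v : ℝ} {μ : ℂ} (hs : IsSimpleAiryEigenvalue bc v μ)
    {g : Side → 𝓢(ℝ, ℂ)} (hg : AirySolution bc v μ g 0)
    (hne : ∃ a ∈ bc.sides, ∃ τ ∈ a.ray, g a τ ≠ 0)
    {f : Side → 𝓢(ℝ, ℂ)} (hf : AirySolution bc v μ f 0) :
    ∃ z : ℂ, ∀ a ∈ bc.sides, ∀ τ ∈ a.ray, f a τ = z * g a τ := by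
  obtain ⟨ψ, -, -, hspan, -⟩ := hs
  obtain ⟨z, hz⟩ := hspan _ (by simpa using hg.airyGraph)
  obtain ⟨y, hy⟩ := hspan _ (by simpa using hf.airyGraph)
  obtain ⟨a₀, ha₀, τ₀, hτ₀, h0⟩ := hne
  have hz0 : z ≠ 0 := fun h => h0 (by rw [hz a₀ ha₀ τ₀ hτ₀, h, zero_mul])
  refine ⟨y / z, fun a ha τ hτ => ?_⟩
  rw [hy a ha τ hτ, hz a ha τ hτ]
  field_simp

/-- The absence of a Jordan block serves as the solvability condition, so that no adjoint operator
is needed. -/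
theorem AirySolution.eq_zero_of_chain {bc : BC} {v : ℝ} {μ : ℂ}
    (hs : IsSimpleAiryEigenvalue bc v μ) {g : Side → 𝓢(ℝ, ℂ)} (hg : AirySolution bc v μ g 0)
    (hne : ∃ a ∈ bc.sides, ∃ τ ∈ a.ray, g a τ ≠ 0) {f : Side → 𝓢(ℝ, ℂ)} {c : ℂ}
    (hf : AirySolution bc v μ f (fun a τ => c * g a τ)) : c = 0 := by
  obtain ⟨ψ, -, -, hspan, hjordan⟩ := hs
  obtain ⟨z, hz⟩ := hspan _ (by simpa using hg.airyGraph)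
  obtain ⟨a₀, ha₀, τ₀, hτ₀, h0⟩ := hne
  have hz0 : z ≠ 0 := fun h => h0 (by rw [hz a₀ ha₀ τ₀ hτ₀, h, zero_mul])
  by_contra hc
  -- Here g = zψ, so the source is czψ and this scaling normalises it to ψ.
  refine hjordan ⟨_, AirySolution.airyGraph (μ := μ) (f := fun a => (c * z)⁻¹ • f a) ?_⟩
  refine ⟨fun a ha τ hτ => ?_, (hf.const_smul _).2⟩
  have := (hf.const_smul (c * z)⁻¹).1 a ha τ hτ
  rw [this]
  simp only [hz a ha τ hτ]
  field_simp

theorem AirySolution.third_deriv {bc : BC} {v : ℝ} {μ : ℂ} {g : Side → 𝓢(ℝ, ℂ)}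
    (hg : AirySolution bc v μ g 0) {a : Side} (ha : a ∈ bc.sides) {τ : ℝ} (hτ : τ ∈ a.ray) :
    schwartzD (schwartzD (schwartzD (g a))) τ
      = (Complex.I * v * τ - μ) * schwartzD (g a) τ + Complex.I * v * g a τ := by
  -- The equation is known only on the ray. One-sided derivatives allow it to be differentiated up
  -- to the end point 0.
  have h1 := (hasDerivAt_schwartzD (schwartzD (schwartzD (g a))) τ).hasDerivWithinAt (s := a.ray)
  have h2 := ((((hasDerivAt_ofReal τ).const_mul (Complex.I * v)).sub_const μ).mul
    (hasDerivAt_schwartzD (g a) τ)).hasDerivWithinAt (s := a.ray)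
  have he : ∀ t ∈ a.ray, schwartzD (schwartzD (g a)) t = (Complex.I * v * t - μ) * g a t := by
    intro t ht
    have := hg.1 a ha t ht
    rw [Pi.zero_apply, Pi.zero_apply, add_zero] at this
    linear_combination -this
  have h3 := h2.congr he (he τ hτ)
  have := (a.uniqueDiffOn_ray τ hτ).eq_deriv _ h1 h3
  rw [this]; ring

/-- The commutator of 𝓛₀ with ∂_τ is -iv, so (𝓛₀ - μ) g' = -iv g and (i/v) g' is a generalised
eigenfunction up to the boundary condition. A multiple of g, chosen independently on each side, may
be added to adjust that condition. -/
theorem AirySolution.chain {bc : BC} {v : ℝ} {μ : ℂ} {g : Side → 𝓢(ℝ, ℂ)}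
    (hg : AirySolution bc v μ g 0) (hv : v ≠ 0) (c : Side → ℂ) {a : Side} (ha : a ∈ bc.sides) {τ : ℝ}
    (hτ : τ ∈ a.ray) :
    -schwartzD (schwartzD ((Complex.I / v) • schwartzD (g a) + c a • g a)) τ
      + Complex.I * v * τ * ((Complex.I / v) • schwartzD (g a) + c a • g a) τ
      = μ * ((Complex.I / v) • schwartzD (g a) + c a • g a) τ + g a τ := by
  have h1 := hg.1 a ha τ hτ
  rw [Pi.zero_apply, Pi.zero_apply, add_zero] at h1
  have hv' : (v : ℂ) ≠ 0 := by exact_mod_cast hv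
  have hI : Complex.I / v * (Complex.I * v) = -1 := by
    field_simp; exact Complex.I_sq
  simp only [schwartzD_smul, schwartzD_add, smul_apply, add_apply,
    smul_eq_mul, hg.third_deriv ha hτ]
  linear_combination c a * h1 - g a τ * hI

/-- On the ray, iv g² has the explicit antiderivative (ivτ - μ) g² - g'². -/
theorem AirySolution.integral_sq {bc : BC} {v : ℝ} {μ : ℂ} {g : Side → 𝓢(ℝ, ℂ)}
    (hg : AirySolution bc v μ g 0) {a : Side} (ha : a ∈ bc.sides) :
    Complex.I * v * ∫ τ in a.ray, g a τ ^ 2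
      = a.sign * (-μ * g a 0 ^ 2 - schwartzD (g a) 0 ^ 2) := by
  set q := schwartzMul (g a) (g a) with hq
  set F : 𝓢(ℝ, ℂ) := (Complex.I * v) • schwartzCoord q + (-μ) • q
    + (-1 : ℂ) • schwartzMul (schwartzD (g a)) (schwartzD (g a)) with hF
  have hd : ∀ τ ∈ a.ray, schwartzD F τ = Complex.I * v * g a τ ^ 2 := by
    intro τ hτ
    have h1 := hg.1 a ha τ hτ
    rw [Pi.zero_apply, Pi.zero_apply, add_zero] at h1
    have hgd := hasDerivAt_schwartzD (g a) τ
    have hgd2 := hasDerivAt_schwartzD (schwartzD (g a)) τ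
    have h2 := ((((hasDerivAt_ofReal τ).mul (hgd.mul hgd)).const_mul (Complex.I * v)).add
      ((hgd.mul hgd).const_mul (-μ))).add ((hgd2.mul hgd2).const_mul (-1))
    have h3 : HasDerivAt F _ τ := h2.congr_of_eventuallyEq (Eventually.of_forall fun t => by
      simp [hF, hq])
    rw [(hasDerivAt_schwartzD F τ).unique h3]
    simp only [Pi.mul_apply]
    linear_combination 2 * schwartzD (g a) τ * h1
  have h4 := integral_ray_schwartzD a F
  rw [setIntegral_congr_fun a.measurableSet_ray hd, integral_const_mul] at h4
  rw [h4]
  simp [hF, hq]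
  ring_nf
  simp

/-- The bilinear square of an eigenfunction for a simple eigenvalue is not zero. -/
theorem AirySolution.total_integral_sq_ne_zero {bc : BC} {v : ℝ} {μ : ℂ}
    (hs : IsSimpleAiryEigenvalue bc v μ) {g : Side → 𝓢(ℝ, ℂ)}
    (hg : AirySolution bc v μ g 0) (hne : ∃ a ∈ bc.sides, ∃ τ ∈ a.ray, g a τ ≠ 0)
    (hv : v ≠ 0) :
    bc.total (fun a => ∫ τ in a.ray, g a τ ^ 2) ≠ 0 := by
  intro h0
  have hb : bc.total (fun a => a.sign * (-μ * g a 0 ^ 2 - schwartzD (g a) 0 ^ 2)) = 0 := by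
    rw [← BC.total_congr (fun a ha => hg.integral_sq ha)]
    have := (bc.total).map_smul (Complex.I * v) (fun a => ∫ τ in a.ray, g a τ ^ 2)
    rw [h0, smul_zero] at this
    exact this
  -- Only the boundary condition for (i/v) g' + c g remains to be met. The equation at τ = 0
  -- replaces g''(0) by -μ g(0).
  suffices H : ∃ c : Side → ℂ,
      bc.Holds (fun a => Complex.I / v * schwartzD (g a) 0 + c a * g a 0)
        (fun a => Complex.I / v * (-μ * g a 0) + c a * schwartzD (g a) 0) by
    obtain ⟨c, hc⟩ := H
    refine one_ne_zero (AirySolution.eq_zero_of_chain hs hg hne (c := 1)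
      (f := fun a => (Complex.I / v) • schwartzD (g a) + c a • g a) ⟨fun a ha τ hτ => ?_, ?_⟩)
    · simp only [one_mul]
      exact hg.chain hv c ha hτ
    · refine hc.congr (fun a _ => by simp) (fun a ha => ?_)
      have h1 := hg.1 a ha 0 a.zero_mem_ray
      rw [Pi.zero_apply, Pi.zero_apply, add_zero] at h1
      simp only [Complex.ofReal_zero, mul_zero, zero_mul, add_zero] at h1
      simp only [schwartzD_smul, schwartzD_add, smul_apply, add_apply,
        smul_eq_mul]
      linear_combination (Complex.I / v) * h1
  have hbc := hg.2
  cases bc with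
  | dirichlet =>
    refine ⟨0, ?_⟩
    simp_all [BC.Holds, BC.total, Side.sign]
  | neumann =>
    refine ⟨0, ?_⟩
    simp_all [BC.Holds, BC.total, Side.sign]
  | robin κ =>
    refine ⟨0, ?_⟩
    simp only [BC.Holds, BC.total, Side.sign, LinearMap.proj_apply] at hbc hb ⊢
    rw [hbc] at hb ⊢
    -- The Robin defect of (i/v) g' is -(i/v)(μ + κ²) g(0), so the vanishing integral removes it.
    have : (μ + κ ^ 2) * g .plus 0 ^ 2 = 0 := by linear_combination hb
    have : (μ + κ ^ 2) * g .plus 0 = 0 := by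
      rcases mul_eq_zero.1 this with h | h
      · rw [h, zero_mul]
      · rw [pow_eq_zero_iff two_ne_zero |>.1 h, mul_zero]
    simp only [Pi.zero_apply, zero_mul, add_zero]
    linear_combination -(Complex.I / v) * this
  | transmission κ =>
    obtain ⟨hb1, hb2⟩ := hbc
    simp only [BC.total, Side.sign, LinearMap.add_apply, LinearMap.proj_apply] at hb
    -- The normal derivatives agree, so their squares cancel and only the difference of the squared
    -- boundary values is left.
    have hq : μ * ((g .plus 0 - g .minus 0) * (g .plus 0 + g .minus 0)) = 0 := by
      linear_combination hb + (schwartzD (g .minus) 0 + schwartzD (g .plus) 0) * hb1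
    simp only [BC.Holds] at hb1 hb2 ⊢
    rw [hb1, hb2]
    by_cases hμ : μ = 0
    · exact ⟨0, by simp [hμ]⟩
    have hq' := (mul_eq_zero.1 hq).resolve_left hμ
    by_cases hκ : (κ : ℂ) = 0
    -- For κ = 0 the two sides decouple into Neumann problems, and g₊ extended by zero is again a
    -- solution. Simplicity then makes one of the boundary values vanish, hence both.
    · obtain ⟨z, hz⟩ := AirySolution.eq_const_mul hs hg hne
        (f := fun a => Side.rec (0 : 𝓢(ℝ, ℂ)) (g .plus) a) ⟨by
          rintro (_ | _) ha τ hτ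
          · simp
          · exact hg.1 _ ha τ hτ, by
          simp only [BC.Holds]
          rw [hb2, hκ]
          simp⟩
      have h1 : (0 : ℂ) = z * g .minus 0 := by
        simpa using hz .minus trivial 0 Side.minus.zero_mem_ray
      have h2 : g .plus 0 = z * g .plus 0 := by
        simpa using hz .plus trivial 0 Side.plus.zero_mem_ray
      have h3 : g .plus 0 * g .minus 0 = 0 := by
        linear_combination g .minus 0 * h2 - g .plus 0 * h1
      have h4 : g .plus 0 = 0 ∧ g .minus 0 = 0 := by
        rcases mul_eq_zero.1 h3 with h | h
        · rw [h, zero_sub, zero_add, neg_mul, neg_eq_zero, mul_self_eq_zero] at hq'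
          exact ⟨h, hq'⟩
        · rw [h, sub_zero, add_zero, mul_self_eq_zero] at hq'
          exact ⟨hq', h⟩
      exact ⟨0, by simp [h4.1, h4.2]⟩
    -- Now g₊(0) = ±g₋(0). With c₋ = 0, the jump condition (sign +) or the equality of the normal
    -- derivatives (sign -) determines a suitable c₊.
    · rcases mul_eq_zero.1 hq' with h | h
      · refine ⟨Side.rec 0 (-(Complex.I / v * μ / κ)), ?_, ?_⟩
        · linear_combination (Complex.I / v * μ + Complex.I / v * μ / κ * κ) * h
        · have h' : g .minus 0 = g .plus 0 := by linear_combination -h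
          simp only [h']
          field_simp
          ring
      · have h' : g .minus 0 = -g .plus 0 := by linear_combination h
        refine ⟨Side.rec 0 (Complex.I / v * μ / κ), ?_, ?_⟩
        · simp only [h']
          field_simp
          ring
        · simp only [h']
          field_simp
          ring

/-! ### Finite sums of products of Schwartz functions -/

theorem mul_mem_tensorSchwartz (φ ψ : 𝓢(ℝ, ℂ)) : (fun σ τ => φ σ * ψ τ) ∈ tensorSchwartz :=
  Submodule.subset_span ⟨φ, ψ, rfl⟩

theorem sum_mem_tensorSchwartz {ι : Type*} [Fintype ι] (φ ψ : ι → 𝓢(ℝ, ℂ)) :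
    (fun σ τ => ∑ i, φ i σ * ψ i τ) ∈ tensorSchwartz := by
  have : (fun σ τ => ∑ i, φ i σ * ψ i τ) = ∑ i, fun σ τ => φ i σ * ψ i τ := by
    ext; simp
  rw [this]
  exact Submodule.sum_mem _ fun i _ => mul_mem_tensorSchwartz _ _

theorem exists_eq_sum_of_mem_tensorSchwartz {f : ℝ → ℝ → ℂ} (hf : f ∈ tensorSchwartz) :
    ∃ (n : ℕ) (φ ψ : Fin n → 𝓢(ℝ, ℂ)), f = fun σ τ => ∑ i, φ i σ * ψ i τ := by
  obtain ⟨n, c, g, rfl⟩ := Submodule.mem_span_set'.1 hf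
  choose φ ψ h using fun i => (g i).2
  refine ⟨n, fun i => c i • φ i, ψ, ?_⟩
  ext σ τ
  simp [h, mul_assoc]

theorem tensorSchwartz_mul {f g : ℝ → ℝ → ℂ} (hf : f ∈ tensorSchwartz)
    (hg : g ∈ tensorSchwartz) : (fun σ τ => f σ τ * g σ τ) ∈ tensorSchwartz := by
  obtain ⟨n, φ, ψ, rfl⟩ := exists_eq_sum_of_mem_tensorSchwartz hf
  obtain ⟨m, φ', ψ', rfl⟩ := exists_eq_sum_of_mem_tensorSchwartz hg
  convert sum_mem_tensorSchwartz (fun p : Fin n × Fin m => schwartzMul (φ p.1) (φ' p.2))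
    (fun p => schwartzMul (ψ p.1) (ψ' p.2)) using 3 with σ τ
  rw [Finset.sum_mul_sum, Fintype.sum_prod_type]
  simp only [schwartzMul_apply]
  exact Finset.sum_congr rfl fun i _ => Finset.sum_congr rfl fun j _ => by ring

theorem tensorSchwartz_coord_mul_left {f : ℝ → ℝ → ℂ} (hf : f ∈ tensorSchwartz) :
    (fun (σ τ : ℝ) => (σ : ℂ) * f σ τ) ∈ tensorSchwartz := by
  obtain ⟨n, φ, ψ, rfl⟩ := exists_eq_sum_of_mem_tensorSchwartz hf
  convert sum_mem_tensorSchwartz (fun i => schwartzCoord (φ i)) ψ using 3 with σ τ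
  simp [Finset.mul_sum, mul_assoc]

theorem tensorSchwartz_coord_mul_right {f : ℝ → ℝ → ℂ} (hf : f ∈ tensorSchwartz) :
    (fun (σ τ : ℝ) => (τ : ℂ) * f σ τ) ∈ tensorSchwartz := by
  obtain ⟨n, φ, ψ, rfl⟩ := exists_eq_sum_of_mem_tensorSchwartz hf
  convert sum_mem_tensorSchwartz φ (fun i => schwartzCoord (ψ i)) using 3 with σ τ
  simp [Finset.mul_sum, mul_left_comm]

theorem tensorSchwartz_reflect {f : ℝ → ℝ → ℂ} (hf : f ∈ tensorSchwartz) :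
    (fun σ τ => f (-σ) τ) ∈ tensorSchwartz := by
  obtain ⟨n, φ, ψ, rfl⟩ := exists_eq_sum_of_mem_tensorSchwartz hf
  exact sum_mem_tensorSchwartz (fun i => schwartzReflect (φ i)) ψ

theorem tensorSchwartz_slice_left {f : ℝ → ℝ → ℂ} (hf : f ∈ tensorSchwartz) (τ : ℝ) :
    ∃ φ : 𝓢(ℝ, ℂ), ∀ σ, f σ τ = φ σ := by
  obtain ⟨n, φ, ψ, rfl⟩ := exists_eq_sum_of_mem_tensorSchwartz hf
  exact ⟨∑ i, ψ i τ • φ i, fun σ => by simp [mul_comm]⟩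

theorem tensorSchwartz_slice_right {f : ℝ → ℝ → ℂ} (hf : f ∈ tensorSchwartz) (σ : ℝ) :
    ∃ ψ : 𝓢(ℝ, ℂ), ∀ τ, f σ τ = ψ τ := by
  obtain ⟨n, φ, ψ, rfl⟩ := exists_eq_sum_of_mem_tensorSchwartz hf
  exact ⟨∑ i, φ i σ • ψ i, fun τ => by simp⟩

theorem tensorSchwartz_integral_left {f : ℝ → ℝ → ℂ} (hf : f ∈ tensorSchwartz) :
    ∃ ψ : 𝓢(ℝ, ℂ), ∀ τ, ∫ σ, f σ τ = ψ τ := by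
  obtain ⟨n, φ, ψ, rfl⟩ := exists_eq_sum_of_mem_tensorSchwartz hf
  refine ⟨∑ i, (∫ σ, φ i σ) • ψ i, fun τ => ?_⟩
  rw [integral_finsetSum _ fun i _ => (φ i).integrable.mul_const _]
  simp [integral_mul_const]

theorem tensorSchwartz_hasDerivAt_left {f : ℝ → ℝ → ℂ} (hf : f ∈ tensorSchwartz) :
    ∃ g ∈ tensorSchwartz, ∀ σ τ, HasDerivAt (fun s => f s τ) (g σ τ) σ := by
  obtain ⟨n, φ, ψ, rfl⟩ := exists_eq_sum_of_mem_tensorSchwartz hf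
  exact ⟨_, sum_mem_tensorSchwartz (fun i => schwartzD (φ i)) ψ, fun σ τ =>
    HasDerivAt.fun_sum fun i _ => (hasDerivAt_schwartzD (φ i) σ).mul_const _⟩

theorem tensorSchwartz_hasDerivAt_right {f : ℝ → ℝ → ℂ} (hf : f ∈ tensorSchwartz) :
    ∃ g ∈ tensorSchwartz, ∀ σ τ, HasDerivAt (fun t => f σ t) (g σ τ) τ := by
  obtain ⟨n, φ, ψ, rfl⟩ := exists_eq_sum_of_mem_tensorSchwartz hf
  exact ⟨_, sum_mem_tensorSchwartz φ (fun i => schwartzD (ψ i)), fun σ τ =>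
    HasDerivAt.fun_sum fun i _ => (hasDerivAt_schwartzD (ψ i) τ).const_mul _⟩

/-! ### Integration over the half-planes -/

/-- The integral over the half-plane of a side. -/
def Side.integral (a : Side) (f : ℝ → ℝ → ℂ) : ℂ := ∫ τ in a.ray, ∫ σ, f σ τ

theorem Side.integral_congr {a : Side} {f g : ℝ → ℝ → ℂ}
    (h : ∀ σ, ∀ τ ∈ a.ray, f σ τ = g σ τ) : a.integral f = a.integral g :=
  setIntegral_congr_fun a.measurableSet_ray fun τ hτ =>
    congrArg (fun F : ℝ → ℂ => ∫ σ, F σ) (funext fun σ => h σ τ hτ)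

theorem tensorSchwartz_integrable {f : ℝ → ℝ → ℂ} (hf : f ∈ tensorSchwartz) (τ : ℝ) :
    Integrable fun σ => f σ τ := by
  obtain ⟨φ, hφ⟩ := tensorSchwartz_slice_left hf τ
  rw [funext hφ]
  exact φ.integrable

theorem tensorSchwartz_integrableOn {f : ℝ → ℝ → ℂ} (hf : f ∈ tensorSchwartz) (s : Set ℝ) :
    IntegrableOn (fun τ => ∫ σ, f σ τ) s := by
  obtain ⟨φ, hφ⟩ := tensorSchwartz_integral_left hf
  rw [funext hφ]
  exact φ.integrable.integrableOn

theorem Side.integral_add (a : Side) {f g : ℝ → ℝ → ℂ} (hf : f ∈ tensorSchwartz)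
    (hg : g ∈ tensorSchwartz) :
    a.integral (fun σ τ => f σ τ + g σ τ) = a.integral f + a.integral g := by
  unfold Side.integral
  simp_rw [fun τ => MeasureTheory.integral_add (tensorSchwartz_integrable hf τ)
    (tensorSchwartz_integrable hg τ)]
  exact MeasureTheory.integral_add (tensorSchwartz_integrableOn hf _)
    (tensorSchwartz_integrableOn hg _)

theorem Side.integral_const_mul (a : Side) (c : ℂ) (f : ℝ → ℝ → ℂ) :
    a.integral (fun σ τ => c * f σ τ) = c * a.integral f := by
  unfold Side.integral
  simp_rw [MeasureTheory.integral_const_mul]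

theorem Side.integral_sum (a : Side) {ι : Type*} (s : Finset ι) {f : ι → ℝ → ℝ → ℂ}
    (hf : ∀ i, f i ∈ tensorSchwartz) :
    a.integral (fun σ τ => ∑ i ∈ s, f i σ τ) = ∑ i ∈ s, a.integral (f i) := by
  classical
  induction s using Finset.induction_on with
  | empty => simp [Side.integral]
  | insert i s hi ih =>
    simp_rw [Finset.sum_insert hi]
    rw [a.integral_add (hf i), ih]
    have : (fun σ τ => ∑ i ∈ s, f i σ τ) = ∑ i ∈ s, f i := by ext; simp
    rw [this]
    exact Submodule.sum_mem _ fun i _ => hf i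

theorem Side.integral_deriv_left (a : Side) {f g : ℝ → ℝ → ℂ} (hf : f ∈ tensorSchwartz)
    (h : ∀ σ τ, HasDerivAt (fun s => f s τ) (g σ τ) σ) : a.integral g = 0 := by
  have (τ : ℝ) : ∫ σ, g σ τ = 0 := by
    obtain ⟨φ, hφ⟩ := tensorSchwartz_slice_left hf τ
    rw [← integral_schwartzD φ]
    congr 1
    ext σ
    exact (funext hφ ▸ h σ τ).unique (hasDerivAt_schwartzD φ σ)
  simp [Side.integral, this]

theorem Side.integral_deriv_right (a : Side) {f g : ℝ → ℝ → ℂ} (hf : f ∈ tensorSchwartz)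
    (h : ∀ σ τ, HasDerivAt (fun t => f σ t) (g σ τ) τ) :
    a.integral g = a.sign * ∫ σ, f σ 0 := by
  obtain ⟨n, φ, ψ, rfl⟩ := exists_eq_sum_of_mem_tensorSchwartz hf
  have hg : g = fun σ τ => ∑ i, φ i σ * schwartzD (ψ i) τ := by
    ext σ τ
    exact (h σ τ).unique
      (HasDerivAt.fun_sum fun i _ => (hasDerivAt_schwartzD (ψ i) τ).const_mul _)
  rw [hg, a.integral_sum _ fun i => mul_mem_tensorSchwartz _ _,
    integral_finsetSum _ fun i _ => (φ i).integrable.mul_const _, Finset.mul_sum]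
  refine Finset.sum_congr rfl fun i _ => ?_
  simp only [Side.integral, MeasureTheory.integral_mul_const,
    MeasureTheory.integral_const_mul, integral_ray_schwartzD]
  ring

/-! ### Derivatives of power series with respect to a parameter -/

/-- Coefficientwise derivative of a power series depending on a real parameter. -/
def HasSeriesDerivAt (p : ℝ → PowerSeries ℂ) (q : PowerSeries ℂ) (x : ℝ) : Prop :=
  ∀ n, HasDerivAt (fun t => coeff n (p t)) (coeff n q) x

theorem hasSeriesDerivAt_const (p : PowerSeries ℂ) (x : ℝ) :
    HasSeriesDerivAt (fun _ => p) 0 x := fun n => by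
  simpa using hasDerivAt_const x (coeff n p)

theorem HasSeriesDerivAt.sub {p p' : ℝ → PowerSeries ℂ} {q q' : PowerSeries ℂ} {x : ℝ}
    (h : HasSeriesDerivAt p q x) (h' : HasSeriesDerivAt p' q' x) :
    HasSeriesDerivAt (fun t => p t - p' t) (q - q') x := fun n => by
  simpa using (h n).fun_sub (h' n)

theorem HasSeriesDerivAt.mul {p p' : ℝ → PowerSeries ℂ} {q q' : PowerSeries ℂ} {x : ℝ}
    (h : HasSeriesDerivAt p q x) (h' : HasSeriesDerivAt p' q' x) :
    HasSeriesDerivAt (fun t => p t * p' t) (q * p' x + p x * q') x := fun n => by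
  simp only [coeff_mul, map_add, ← Finset.sum_add_distrib]
  exact HasDerivAt.fun_sum fun i _ => (h i.1).mul (h' i.2)

theorem HasSeriesDerivAt.unique {p : ℝ → PowerSeries ℂ} {q q' : PowerSeries ℂ} {x : ℝ}
    (h : HasSeriesDerivAt p q x) (h' : HasSeriesDerivAt p q' x) : q = q' :=
  PowerSeries.ext fun n => (h n).unique (h' n)

theorem HasSeriesDerivAt.congr_deriv {p : ℝ → PowerSeries ℂ} {q q' : PowerSeries ℂ} {x : ℝ}
    (h : HasSeriesDerivAt p q x) (e : q = q') : HasSeriesDerivAt p q' x := e ▸ h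

theorem hasSeriesDerivAt_C {f : ℝ → ℂ} {f' : ℂ} {x : ℝ} (h : HasDerivAt f f' x) :
    HasSeriesDerivAt (fun t => C (f t)) (C f') x := fun n => by
  simp only [coeff_C]
  split_ifs
  · exact h
  · exact hasDerivAt_const _ _

/-- The recursion for the coefficients of an inverse gives differentiability. The value of the
derivative then follows by differentiating p p⁻¹ = 1. -/
theorem HasSeriesDerivAt.inv {p : ℝ → PowerSeries ℂ} {q : PowerSeries ℂ} {x : ℝ}
    (h : HasSeriesDerivAt p q x) (h1 : ∀ t, constantCoeff (p t) = 1) :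
    HasSeriesDerivAt (fun t => (p t)⁻¹) (-((p x)⁻¹ ^ 2 * q)) x := by
  have hd (n : ℕ) : DifferentiableAt ℝ (fun t => coeff n (p t)⁻¹) x := by
    induction n using Nat.strong_induction_on with
    | _ n ih =>
      simp only [coeff_inv n, h1]
      split_ifs
      · exact differentiableAt_const _
      · refine DifferentiableAt.const_mul (DifferentiableAt.fun_sum fun i _ => ?_) _
        split_ifs with hi
        · exact (h i.1).differentiableAt.mul (ih _ hi)
        · exact differentiableAt_const _
  have hr : HasSeriesDerivAt (fun t => (p t)⁻¹)
      (PowerSeries.mk fun n => deriv (fun t => coeff n (p t)⁻¹) x) x := fun n => by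
    rw [coeff_mk]; exact (hd n).hasDerivAt
  have hm (t : ℝ) : p t * (p t)⁻¹ = 1 := PowerSeries.mul_inv_cancel _ (by simp [h1])
  have h2 := (h.mul hr).unique (by simpa only [hm] using hasSeriesDerivAt_const 1 x)
  have : -((p x)⁻¹ ^ 2 * q) = PowerSeries.mk fun n => deriv (fun t => coeff n (p t)⁻¹) x := by
    linear_combination -(p x)⁻¹ * h2
      + (PowerSeries.mk fun n => deriv (fun t => coeff n (p t)⁻¹) x) * hm x
  rw [this]; exact hr

theorem HasSeriesDerivAt.rescale {p : ℝ → PowerSeries ℂ} {q : PowerSeries ℂ} {x : ℝ}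
    (h : HasSeriesDerivAt p q x) (c : ℂ) :
    HasSeriesDerivAt (fun t => PowerSeries.rescale c (p t)) (PowerSeries.rescale c q) x :=
  fun n => by
    simp only [coeff_rescale]
    exact (h n).const_mul _

theorem HasSeriesDerivAt.comp_neg {p : ℝ → PowerSeries ℂ} {q : PowerSeries ℂ} {x : ℝ}
    (h : HasSeriesDerivAt p q (-x)) : HasSeriesDerivAt (fun t => p (-t)) (-q) x := fun n =>
  ((h n).scomp x (hasDerivAt_neg x)).congr_deriv (by simp)

/-! ### Series with coefficients in the Schwartz space, and their multipliers -/

/-- All coefficients are finite sums of products of Schwartz functions. -/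
def SchwartzSeries (P : ℝ → ℝ → PowerSeries ℂ) : Prop :=
  ∀ n, (fun σ τ => coeff n (P σ τ)) ∈ tensorSchwartz

/-- Multiplication by each coefficient preserves finite sums of products of Schwartz functions. -/
def MultiplierSeries (P : ℝ → ℝ → PowerSeries ℂ) : Prop :=
  ∀ n, ∀ f ∈ tensorSchwartz, (fun σ τ => coeff n (P σ τ) * f σ τ) ∈ tensorSchwartz

theorem tensorSchwartz_finset_sum {ι : Type*} (s : Finset ι) {f : ι → ℝ → ℝ → ℂ}
    (hf : ∀ i ∈ s, f i ∈ tensorSchwartz) : (fun σ τ => ∑ i ∈ s, f i σ τ) ∈ tensorSchwartz := by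
  have : (fun σ τ => ∑ i ∈ s, f i σ τ) = ∑ i ∈ s, f i := by ext; simp
  rw [this]
  exact Submodule.sum_mem _ hf

theorem SchwartzSeries.mul {P Q : ℝ → ℝ → PowerSeries ℂ} (hP : SchwartzSeries P)
    (hQ : SchwartzSeries Q) : SchwartzSeries fun σ τ => P σ τ * Q σ τ := fun n => by
  simp only [coeff_mul]
  exact tensorSchwartz_finset_sum _ fun i _ => tensorSchwartz_mul (hP i.1) (hQ i.2)

theorem SchwartzSeries.sub {P Q : ℝ → ℝ → PowerSeries ℂ} (hP : SchwartzSeries P)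
    (hQ : SchwartzSeries Q) : SchwartzSeries fun σ τ => P σ τ - Q σ τ := fun n => by
  simp only [map_sub]
  exact Submodule.sub_mem _ (hP n) (hQ n)

theorem MultiplierSeries.smul {P Q : ℝ → ℝ → PowerSeries ℂ} (hP : MultiplierSeries P)
    (hQ : SchwartzSeries Q) : SchwartzSeries fun σ τ => P σ τ * Q σ τ := fun n => by
  simp only [coeff_mul]
  exact tensorSchwartz_finset_sum _ fun i _ => hP i.1 _ (hQ i.2)

theorem multiplierSeries_const (p : PowerSeries ℂ) : MultiplierSeries fun _ _ => p :=
  fun _ _ hf => Submodule.smul_mem _ _ hf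

theorem MultiplierSeries.mul {P Q : ℝ → ℝ → PowerSeries ℂ} (hP : MultiplierSeries P)
    (hQ : MultiplierSeries Q) : MultiplierSeries fun σ τ => P σ τ * Q σ τ := fun n f hf => by
  simp only [coeff_mul, Finset.sum_mul, mul_assoc]
  exact tensorSchwartz_finset_sum _ fun i _ => hP i.1 _ (hQ i.2 _ hf)

theorem MultiplierSeries.sub {P Q : ℝ → ℝ → PowerSeries ℂ} (hP : MultiplierSeries P)
    (hQ : MultiplierSeries Q) : MultiplierSeries fun σ τ => P σ τ - Q σ τ := fun n f hf => by
  simp only [map_sub, sub_mul]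
  exact Submodule.sub_mem _ (hP n f hf) (hQ n f hf)

theorem MultiplierSeries.inv {P : ℝ → ℝ → PowerSeries ℂ} (hP : MultiplierSeries P)
    (h1 : ∀ σ τ, constantCoeff (P σ τ) = 1) : MultiplierSeries fun σ τ => (P σ τ)⁻¹ := fun n => by
  induction n using Nat.strong_induction_on with
  | _ n ih =>
    intro f hf
    simp only [coeff_inv n, h1]
    split_ifs
    · simpa using hf
    · simp only [inv_one, neg_mul, one_mul, Finset.sum_mul]
      refine Submodule.neg_mem _ (tensorSchwartz_finset_sum _ fun i _ => ?_)
      split_ifs with hi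
      · simp only [mul_assoc]
        exact hP _ _ (ih _ hi _ hf)
      · simp only [zero_mul]
        exact tensorSchwartz.zero_mem

namespace BoundaryFrame

variable {bc : BC} {G : Set Plane} {x₀ : Plane}

/-! ### The coefficients of the formal operator -/

theorem constantCoeff_aSeries (F : BoundaryFrame bc G x₀) (σ τ : ℝ) :
    constantCoeff (F.aSeries σ τ) = 1 := by
  simp [aSeries]

theorem aSeries_mul_inv (F : BoundaryFrame bc G x₀) (σ τ : ℝ) :
    F.aSeries σ τ * (F.aSeries σ τ)⁻¹ = 1 :=
  PowerSeries.mul_inv_cancel _ (by simp [constantCoeff_aSeries])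

theorem aSeries_zero (F : BoundaryFrame bc G x₀) (σ : ℝ) : F.aSeries σ 0 = 1 := by
  simp [aSeries]

/-- The factor X³ is the chain rule for s = X³σ. -/
theorem hasSeriesDerivAt_cSeries (F : BoundaryFrame bc G x₀) (σ : ℝ) :
    HasSeriesDerivAt F.cSeries (X ^ 3 * F.cDerivSeries σ) σ := fun n => by
  simp only [cSeries, cDerivSeries, coeff_mk, coeff_X_pow_mul']
  by_cases h : 3 ∣ n
  · obtain ⟨m, rfl⟩ := h
    simp only [dvd_mul_right, if_true, Nat.mul_div_cancel_left m three_pos]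
    cases m with
    | zero => simpa using hasDerivAt_const σ _
    | succ m =>
      have e1 : 3 * (m + 1) - 3 = 3 * m := by omega
      rw [if_pos (by omega), e1, if_pos (dvd_mul_right _ _), Nat.mul_div_cancel_left m three_pos]
      refine (((hasDerivAt_pow (m + 1) σ).const_mul
        (F.c (m + 1) / ((m + 1).factorial : ℝ))).ofReal_comp).congr_deriv ?_
      rw [Nat.factorial_succ]
      push_cast
      have : (m : ℂ) + 1 ≠ 0 := by exact_mod_cast Nat.succ_ne_zero m
      have : (m.factorial : ℂ) ≠ 0 := by exact_mod_cast Nat.factorial_ne_zero m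
      field_simp
  · simp only [h, if_false]
    have h' : ¬ (3 ≤ n ∧ 3 ∣ n - 3) := fun h' => h (by omega)
    split_ifs
    · tauto
    · exact hasDerivAt_const _ _
    · exact hasDerivAt_const _ _

theorem hasSeriesDerivAt_aSeries_left (F : BoundaryFrame bc G x₀) (σ τ : ℝ) :
    HasSeriesDerivAt (fun s => F.aSeries s τ) (X ^ 3 * F.asSeries σ τ) σ := by
  have h := (hasSeriesDerivAt_const 1 σ).sub
    ((hasSeriesDerivAt_const (X ^ 4 * C (τ : ℂ)) σ).mul (F.hasSeriesDerivAt_cSeries σ))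
  exact h.congr_deriv (by rw [asSeries]; ring)

theorem hasSeriesDerivAt_aSeries_right (F : BoundaryFrame bc G x₀) (σ τ : ℝ) :
    HasSeriesDerivAt (fun t => F.aSeries σ t) (X ^ 4 * F.aρSeries σ) τ := by
  have h := (hasSeriesDerivAt_const 1 τ).sub
    (((hasSeriesDerivAt_const (X ^ 4) τ).mul (hasSeriesDerivAt_C (hasDerivAt_ofReal τ))).mul
      (hasSeriesDerivAt_const (F.cSeries σ) τ))
  exact h.congr_deriv (by rw [aρSeries, map_one]; ring)

theorem multiplierSeries_cSeries (F : BoundaryFrame bc G x₀) :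
    MultiplierSeries fun σ _ => F.cSeries σ := fun n f hf => by
  simp only [cSeries, coeff_mk]
  split_ifs
  · have hp (m : ℕ) : (fun (σ τ : ℝ) => (σ : ℂ) ^ m * f σ τ) ∈ tensorSchwartz := by
      induction m with
      | zero => simpa using hf
      | succ m ih =>
        simp only [pow_succ', mul_assoc]
        exact tensorSchwartz_coord_mul_left ih
    simp only [Complex.ofReal_mul, Complex.ofReal_pow, mul_assoc]
    exact Submodule.smul_mem _ _ (hp _)
  · simp only [zero_mul]
    exact tensorSchwartz.zero_mem

theorem multiplierSeries_C_coord : MultiplierSeries fun _ τ => C (τ : ℂ) := fun n f hf => by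
  simp only [coeff_C]
  split_ifs
  · exact tensorSchwartz_coord_mul_right hf
  · simp only [zero_mul]
    exact tensorSchwartz.zero_mem

theorem multiplierSeries_aSeries (F : BoundaryFrame bc G x₀) : MultiplierSeries F.aSeries :=
  (multiplierSeries_const 1).sub
    (((multiplierSeries_const (X ^ 4)).mul multiplierSeries_C_coord).mul
      F.multiplierSeries_cSeries)

/-- The formal operator applied to a series with given derivatives. -/
def opJet (F : BoundaryFrame bc G x₀) (V : Plane → ℝ) (σ τ : ℝ)
    (f fσ fσσ fτ fττ : PowerSeries ℂ) : PowerSeries ℂ :=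
  -fττ - X ^ 2 * (F.aSeries σ τ)⁻¹ ^ 2 * fσσ
    - X ^ 4 * (F.aSeries σ τ)⁻¹ * F.aρSeries σ * fτ
    + X ^ 5 * (F.aSeries σ τ)⁻¹ ^ 3 * F.asSeries σ τ * fσ
    + C Complex.I * F.VShiftSeries V σ τ * f

theorem coeff_mul_mk (B : PowerSeries ℂ) (g : ℕ → ℂ) (n : ℕ) :
    coeff n (B * PowerSeries.mk g)
      = ∑ p ∈ Finset.HasAntidiagonal.antidiagonal n, coeff p.1 (B * C (g p.2)) := by
  rw [coeff_mul]
  simp only [coeff_mul_C, coeff_mk]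

theorem opSeries_eq_opJet (F : BoundaryFrame bc G x₀) (V : Plane → ℝ)
    {f fσ fσσ fτ fττ : ℝ → ℝ → ℂ}
    (hσ : ∀ σ τ, HasDerivAt (fun s => f s τ) (fσ σ τ) σ)
    (hσσ : ∀ σ τ, HasDerivAt (fun s => fσ s τ) (fσσ σ τ) σ)
    (hτ : ∀ σ τ, HasDerivAt (fun t => f σ t) (fτ σ τ) τ)
    (hττ : ∀ σ τ, HasDerivAt (fun t => fτ σ t) (fττ σ τ) τ) (σ τ : ℝ) :
    F.opSeries V f σ τ = F.opJet V σ τ (C (f σ τ)) (C (fσ σ τ)) (C (fσσ σ τ)) (C (fτ σ τ))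
      (C (fττ σ τ)) := by
  have e1 : deriv (fun s => f s τ) = fun s => fσ s τ := funext fun s => (hσ s τ).deriv
  have e2 : deriv (fun t => f σ t) = fun t => fτ σ t := funext fun t => (hτ σ t).deriv
  rw [opSeries, opJet]
  simp only [iteratedDeriv_succ, iteratedDeriv_zero, e1, e2, (hσσ σ τ).deriv, (hττ σ τ).deriv]

/-- Linearity in the jet makes this a Cauchy product, which turns the hierarchy of equations for the
`u j` into one identity of power series. -/
theorem coeff_opJet_mk (F : BoundaryFrame bc G x₀) (V : Plane → ℝ) (σ τ : ℝ)
    (f fσ fσσ fτ fττ : ℕ → ℂ) (n : ℕ) :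
    coeff n (F.opJet V σ τ (PowerSeries.mk f) (PowerSeries.mk fσ) (PowerSeries.mk fσσ)
        (PowerSeries.mk fτ) (PowerSeries.mk fττ))
      = ∑ p ∈ Finset.HasAntidiagonal.antidiagonal n,
          coeff p.1 (F.opJet V σ τ (C (f p.2)) (C (fσ p.2)) (C (fσσ p.2)) (C (fτ p.2))
            (C (fττ p.2))) := by
  simp only [opJet, map_add, map_sub, Finset.sum_add_distrib, Finset.sum_sub_distrib,
    coeff_mul_mk, neg_eq_neg_one_mul (PowerSeries.mk fττ),
    fun z : ℂ => neg_eq_neg_one_mul (C z)]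

/-! ### Symmetry of the formal operator -/

theorem hasSeriesDerivAt_left_bracket (F : BoundaryFrame bc G x₀) {σ τ : ℝ}
    {U Uσ W Wσ : ℝ → PowerSeries ℂ} {Uσσ Wσσ : PowerSeries ℂ}
    (hU : HasSeriesDerivAt U (Uσ σ) σ) (hU' : HasSeriesDerivAt Uσ Uσσ σ)
    (hW : HasSeriesDerivAt W (Wσ σ) σ) (hW' : HasSeriesDerivAt Wσ Wσσ σ) :
    HasSeriesDerivAt (fun s => X ^ 2 * (F.aSeries s τ)⁻¹ * (W s * Uσ s - U s * Wσ s))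
      (X ^ 2 * (-((F.aSeries σ τ)⁻¹ ^ 2 * (X ^ 3 * F.asSeries σ τ)))
          * (W σ * Uσ σ - U σ * Wσ σ)
        + X ^ 2 * (F.aSeries σ τ)⁻¹ * (W σ * Uσσ - U σ * Wσσ)) σ := by
  have h := ((hasSeriesDerivAt_const (X ^ 2) σ).mul ((F.hasSeriesDerivAt_aSeries_left σ τ).inv
    fun t => F.constantCoeff_aSeries t τ)).mul ((hW.mul hU').sub (hU.mul hW'))
  exact h.congr_deriv (by ring)

theorem hasSeriesDerivAt_right_bracket (F : BoundaryFrame bc G x₀) {σ τ : ℝ}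
    {U Uτ W Wτ : ℝ → PowerSeries ℂ} {Uττ Wττ : PowerSeries ℂ}
    (hU : HasSeriesDerivAt U (Uτ τ) τ) (hU' : HasSeriesDerivAt Uτ Uττ τ)
    (hW : HasSeriesDerivAt W (Wτ τ) τ) (hW' : HasSeriesDerivAt Wτ Wττ τ) :
    HasSeriesDerivAt (fun t => F.aSeries σ t * (W t * Uτ t - U t * Wτ t))
      (X ^ 4 * F.aρSeries σ * (W τ * Uτ τ - U τ * Wτ τ)
        + F.aSeries σ τ * (W τ * Uττ - U τ * Wττ)) τ := by
  have h := (F.hasSeriesDerivAt_aSeries_right σ τ).mul ((hW.mul hU').sub (hU.mul hW'))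
  exact h.congr_deriv (by ring)

/-- Lagrange's identity. After multiplication by `a` the operator is -∂_σ(X² a⁻¹ ∂_σ) - ∂_τ(a ∂_τ)
plus a potential, so the antisymmetrised product is minus the divergence of the two brackets
differentiated above, and the potential drops out. -/
theorem aSeries_mul_opJet_sub (F : BoundaryFrame bc G x₀) (V : Plane → ℝ) (σ τ : ℝ)
    (U Uσ Uσσ Uτ Uττ W Wσ Wσσ Wτ Wττ : PowerSeries ℂ) :
    F.aSeries σ τ * (W * F.opJet V σ τ U Uσ Uσσ Uτ Uττ - U * F.opJet V σ τ W Wσ Wσσ Wτ Wττ)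
      = -(X ^ 2 * (-((F.aSeries σ τ)⁻¹ ^ 2 * (X ^ 3 * F.asSeries σ τ))) * (W * Uσ - U * Wσ)
          + X ^ 2 * (F.aSeries σ τ)⁻¹ * (W * Uσσ - U * Wσσ))
        - (X ^ 4 * F.aρSeries σ * (W * Uτ - U * Wτ)
          + F.aSeries σ τ * (W * Uττ - U * Wττ)) := by
  have h := F.aSeries_mul_inv σ τ
  set w := (F.aSeries σ τ)⁻¹
  simp only [opJet]
  linear_combination (-X ^ 2 * w * (W * Uσσ - U * Wσσ)
    - X ^ 4 * F.aρSeries σ * (W * Uτ - U * Wτ)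
    + X ^ 5 * w ^ 2 * F.asSeries σ τ * (W * Uσ - U * Wσ)) * h

/-! ### Reflection -/

theorem neg_one_pow_mul_ite_three_dvd (n : ℕ) (b σ : ℝ) :
    ((-1 : ℂ) ^ n * if 3 ∣ n then ((b * (-σ) ^ (n / 3) : ℝ) : ℂ) else 0)
      = if 3 ∣ n then ((b * σ ^ (n / 3) : ℝ) : ℂ) else 0 := by
  split_ifs with h
  · obtain ⟨m, rfl⟩ := h
    rw [Nat.mul_div_cancel_left m three_pos, neg_pow σ]
    push_cast
    have : ((-1 : ℂ) ^ (3 * m)) * (-1) ^ m = 1 := by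
      rw [← pow_add]; exact Even.neg_one_pow ⟨2 * m, by ring⟩
    linear_combination (b * σ ^ m : ℂ) * this
  · simp

theorem rescale_cSeries (F : BoundaryFrame bc G x₀) (σ : ℝ) :
    PowerSeries.rescale (-1) (F.cSeries (-σ)) = F.cSeries σ := by
  ext n
  simp only [coeff_rescale, cSeries, coeff_mk]
  exact neg_one_pow_mul_ite_three_dvd _ _ _

theorem rescale_cDerivSeries (F : BoundaryFrame bc G x₀) (σ : ℝ) :
    PowerSeries.rescale (-1) (F.cDerivSeries (-σ)) = F.cDerivSeries σ := by
  ext n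
  simp only [coeff_rescale, cDerivSeries, coeff_mk]
  exact neg_one_pow_mul_ite_three_dvd _ _ _

theorem rescale_C (c z : ℂ) : PowerSeries.rescale c (C z) = C z := by
  ext n
  simp only [coeff_rescale, coeff_C]
  split_ifs with h <;> simp [h]

theorem rescale_aSeries (F : BoundaryFrame bc G x₀) (σ τ : ℝ) :
    PowerSeries.rescale (-1) (F.aSeries (-σ) τ) = F.aSeries σ τ := by
  simp only [aSeries, map_sub, map_one, map_mul, map_pow, rescale_neg_one_X, rescale_C,
    rescale_cSeries]
  ring

theorem rescale_aSeries_inv (F : BoundaryFrame bc G x₀) (σ τ : ℝ) :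
    PowerSeries.rescale (-1) (F.aSeries (-σ) τ)⁻¹ = (F.aSeries σ τ)⁻¹ := by
  have h := congrArg (PowerSeries.rescale (-1 : ℂ)) (F.aSeries_mul_inv (-σ) τ)
  rw [map_mul, rescale_aSeries, map_one] at h
  linear_combination (F.aSeries σ τ)⁻¹ * h
    - PowerSeries.rescale (-1) (F.aSeries (-σ) τ)⁻¹ * F.aSeries_mul_inv σ τ

theorem rescale_VShiftSeries (F : BoundaryFrame bc G x₀) (V : Plane → ℝ) (σ τ : ℝ) :
    PowerSeries.rescale (-1) (F.VShiftSeries V (-σ) τ) = F.VShiftSeries V σ τ := by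
  ext n
  simp only [coeff_rescale, VShiftSeries, VSeries, coeff_mk, Finset.mul_sum]
  refine Finset.sum_congr rfl fun k _ => Finset.sum_congr rfl fun p _ => ?_
  split_ifs with h
  -- Here 3k + 4p = n + 4, so k and n have the same parity.
  · have : (-1 : ℂ) ^ n * (-1) ^ k = 1 := by
      rw [← pow_add]; exact Even.neg_one_pow (by rw [Nat.even_iff]; omega)
    rw [neg_pow σ]
    push_cast
    linear_combination (F.v V k p * σ ^ k * τ ^ p : ℂ) * this
  · simp

/-- The coefficients are invariant, and the only odd explicit power, X⁵, multiplies the only term of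
odd order in ∂_σ; the two signs compensate. -/
theorem rescale_opJet (F : BoundaryFrame bc G x₀) (V : Plane → ℝ) (σ τ : ℝ)
    (f fσ fσσ fτ fττ : PowerSeries ℂ) :
    PowerSeries.rescale (-1) (F.opJet V (-σ) τ f fσ fσσ fτ fττ)
      = F.opJet V σ τ (PowerSeries.rescale (-1) f) (-PowerSeries.rescale (-1) fσ)
          (PowerSeries.rescale (-1) fσσ) (PowerSeries.rescale (-1) fτ)
          (PowerSeries.rescale (-1) fττ) := by
  simp only [opJet, aρSeries, asSeries, map_sub, map_add, map_neg, map_mul, map_pow,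
    rescale_neg_one_X, rescale_C, rescale_cSeries, rescale_cDerivSeries, rescale_aSeries_inv,
    rescale_VShiftSeries]
  ring

/-! ### The first operators -/

theorem L_zero (F : BoundaryFrame bc G x₀) (V : Plane → ℝ) (f : ℝ → ℝ → ℂ) (σ τ : ℝ) :
    F.L V 0 f σ τ = -iteratedDeriv 2 (fun t => f σ t) τ
      + Complex.I * F.v V 0 1 * τ * f σ τ := by
  simp only [L, opSeries, map_add, map_sub, map_neg, mul_assoc, coeff_X_pow_mul', coeff_C_mul,
    coeff_mul_C]
  simp [VShiftSeries, VSeries, Finset.sum_range_succ]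
  ring

/-- The potential contributes nothing because 3k + 4p = 5 has no solution in natural numbers. -/
theorem L_one (F : BoundaryFrame bc G x₀) (V : Plane → ℝ) (f : ℝ → ℝ → ℂ) (σ τ : ℝ) :
    F.L V 1 f σ τ = 0 := by
  simp only [L, opSeries, map_add, map_sub, map_neg, mul_assoc, coeff_X_pow_mul', coeff_C_mul,
    coeff_mul_C]
  simp [VShiftSeries, VSeries, Finset.sum_range_succ]

theorem L_two (F : BoundaryFrame bc G x₀) (V : Plane → ℝ) (f : ℝ → ℝ → ℂ) (σ τ : ℝ) :
    F.L V 2 f σ τ = -iteratedDeriv 2 (fun s => f s τ) σ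
      + Complex.I * F.v V 2 0 * σ ^ 2 * f σ τ := by
  simp only [L, opSeries, map_add, map_sub, map_neg, mul_assoc, coeff_X_pow_mul', coeff_C_mul,
    coeff_mul_C]
  simp [VShiftSeries, VSeries, Finset.sum_range_succ, constantCoeff_aSeries]
  ring

end BoundaryFrame

/-! ### Green's formula for formal series -/

/-- A series with Schwartz coefficients, together with its derivatives up to order two. -/
structure SeriesJet (U Uσ Uσσ Uτ Uττ : ℝ → ℝ → PowerSeries ℂ) : Prop where
  mem : SchwartzSeries U
  memσ : SchwartzSeries Uσ
  memτ : SchwartzSeries Uτ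
  derivσ : ∀ σ τ, HasSeriesDerivAt (fun s => U s τ) (Uσ σ τ) σ
  derivσσ : ∀ σ τ, HasSeriesDerivAt (fun s => Uσ s τ) (Uσσ σ τ) σ
  derivτ : ∀ σ τ, HasSeriesDerivAt (fun t => U σ t) (Uτ σ τ) τ
  derivττ : ∀ σ τ, HasSeriesDerivAt (fun t => Uτ σ t) (Uττ σ τ) τ

theorem SchwartzSeries.reflect {P : ℝ → ℝ → PowerSeries ℂ} (h : SchwartzSeries P) :
    SchwartzSeries fun σ τ => PowerSeries.rescale (-1) (P (-σ) τ) := fun n => by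
  simp only [coeff_rescale]
  exact Submodule.smul_mem _ ((-1 : ℂ) ^ n) (tensorSchwartz_reflect (h n))

theorem SchwartzSeries.neg {P : ℝ → ℝ → PowerSeries ℂ} (h : SchwartzSeries P) :
    SchwartzSeries fun σ τ => -P σ τ := fun n => by
  simp only [map_neg]
  exact Submodule.neg_mem _ (h n)

theorem HasSeriesDerivAt.neg {p : ℝ → PowerSeries ℂ} {q : PowerSeries ℂ} {x : ℝ}
    (h : HasSeriesDerivAt p q x) : HasSeriesDerivAt (fun t => -p t) (-q) x := fun n => by
  simpa using (h n).fun_neg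

/-- The jet of `U(-h^(1/6); -σ, τ)`. -/
theorem SeriesJet.reflect {U Uσ Uσσ Uτ Uττ : ℝ → ℝ → PowerSeries ℂ}
    (h : SeriesJet U Uσ Uσσ Uτ Uττ) :
    SeriesJet (fun σ τ => PowerSeries.rescale (-1) (U (-σ) τ))
      (fun σ τ => -PowerSeries.rescale (-1) (Uσ (-σ) τ))
      (fun σ τ => PowerSeries.rescale (-1) (Uσσ (-σ) τ))
      (fun σ τ => PowerSeries.rescale (-1) (Uτ (-σ) τ))
      (fun σ τ => PowerSeries.rescale (-1) (Uττ (-σ) τ)) where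
  mem := h.mem.reflect
  memσ := h.memσ.reflect.neg
  memτ := h.memτ.reflect
  derivσ σ τ := ((h.derivσ (-σ) τ).comp_neg.rescale (-1)).congr_deriv (by simp)
  derivσσ σ τ := ((h.derivσσ (-σ) τ).comp_neg.rescale (-1)).neg.congr_deriv (by simp)
  derivτ σ τ := (h.derivτ (-σ) τ).rescale (-1)
  derivττ σ τ := (h.derivττ (-σ) τ).rescale (-1)

theorem mem_tensorSchwartz_of_hasDerivAt_left {f g : ℝ → ℝ → ℂ} (hf : f ∈ tensorSchwartz)
    (h : ∀ σ τ, HasDerivAt (fun s => f s τ) (g σ τ) σ) : g ∈ tensorSchwartz := by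
  obtain ⟨g', hg', h'⟩ := tensorSchwartz_hasDerivAt_left hf
  rwa [show g = g' from funext₂ fun σ τ => (h σ τ).unique (h' σ τ)]

theorem mem_tensorSchwartz_of_hasDerivAt_right {f g : ℝ → ℝ → ℂ} (hf : f ∈ tensorSchwartz)
    (h : ∀ σ τ, HasDerivAt (fun t => f σ t) (g σ τ) τ) : g ∈ tensorSchwartz := by
  obtain ⟨g', hg', h'⟩ := tensorSchwartz_hasDerivAt_right hf
  rwa [show g = g' from funext₂ fun σ τ => (h σ τ).unique (h' σ τ)]

/-- Lagrange's identity is integrated coefficient by coefficient. The σ-flux integrates to zero by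
decay, and the τ-flux leaves the Wronskian at τ = 0, where a = 1. -/
theorem BoundaryFrame.green {bc : BC} {G : Set Plane} {x₀ : Plane} (F : BoundaryFrame bc G x₀)
    (V : Plane → ℝ) (a : Side) {Λ M : PowerSeries ℂ}
    {U Uσ Uσσ Uτ Uττ W Wσ Wσσ Wτ Wττ : ℝ → ℝ → PowerSeries ℂ}
    (hU : SeriesJet U Uσ Uσσ Uτ Uττ) (hW : SeriesJet W Wσ Wσσ Wτ Wττ)
    (eU : ∀ σ, ∀ τ ∈ a.ray,
      F.opJet V σ τ (U σ τ) (Uσ σ τ) (Uσσ σ τ) (Uτ σ τ) (Uττ σ τ) = Λ * U σ τ)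
    (eW : ∀ σ, ∀ τ ∈ a.ray,
      F.opJet V σ τ (W σ τ) (Wσ σ τ) (Wσσ σ τ) (Wτ σ τ) (Wττ σ τ) = M * W σ τ) (n : ℕ) :
    ∑ p ∈ Finset.HasAntidiagonal.antidiagonal n, coeff p.1 (Λ - M)
        * a.integral (fun σ τ => coeff p.2 (F.aSeries σ τ * (U σ τ * W σ τ)))
      = -(a.sign * ∫ σ, coeff n (W σ 0 * Uτ σ 0 - U σ 0 * Wτ σ 0)) := by
  have hL : SchwartzSeries fun σ τ =>
      X ^ 2 * (F.aSeries σ τ)⁻¹ * (W σ τ * Uσ σ τ - U σ τ * Wσ σ τ) :=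
    ((multiplierSeries_const (X ^ 2)).mul
      (F.multiplierSeries_aSeries.inv F.constantCoeff_aSeries)).smul
        ((hW.mem.mul hU.memσ).sub (hU.mem.mul hW.memσ))
  have hR : SchwartzSeries fun σ τ =>
      F.aSeries σ τ * (W σ τ * Uτ σ τ - U σ τ * Wτ σ τ) :=
    F.multiplierSeries_aSeries.smul ((hW.mem.mul hU.memτ).sub (hU.mem.mul hW.memτ))
  have hM : SchwartzSeries fun σ τ => F.aSeries σ τ * (U σ τ * W σ τ) :=
    F.multiplierSeries_aSeries.smul (hU.mem.mul hW.mem)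
  have dL (σ τ : ℝ) := F.hasSeriesDerivAt_left_bracket (U := fun s => U s τ)
    (W := fun s => W s τ) (Uσ := fun s => Uσ s τ) (Wσ := fun s => Wσ s τ) (τ := τ)
    (hU.derivσ σ τ) (hU.derivσσ σ τ) (hW.derivσ σ τ) (hW.derivσσ σ τ) n
  have dR (σ τ : ℝ) := F.hasSeriesDerivAt_right_bracket (σ := σ)
    (hU.derivτ σ τ) (hU.derivττ σ τ) (hW.derivτ σ τ) (hW.derivττ σ τ) n
  have iL := a.integral_deriv_left (hL n) dL
  have iR := a.integral_deriv_right (hR n) dR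
  have mL := mem_tensorSchwartz_of_hasDerivAt_left (hL n) dL
  have mR := mem_tensorSchwartz_of_hasDerivAt_right (hR n) dR
  have key := a.integral_add mL mR
  rw [iL, iR, zero_add] at key
  simp only [F.aSeries_zero, one_mul] at key
  rw [← key, ← neg_one_mul, ← a.integral_const_mul]
  simp_rw [← a.integral_const_mul]
  have hsum := a.integral_sum (Finset.HasAntidiagonal.antidiagonal n)
    (f := fun p σ τ => coeff p.1 (Λ - M) * coeff p.2 (F.aSeries σ τ * (U σ τ * W σ τ)))
    fun p => Submodule.smul_mem _ (coeff p.1 (Λ - M)) (hM p.2)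
  rw [← hsum]
  refine Side.integral_congr fun σ τ hτ => ?_
  rw [← coeff_mul, ← map_add, neg_one_mul, ← map_neg]
  congr 1
  have h := F.aSeries_mul_opJet_sub V σ τ (U σ τ) (Uσ σ τ) (Uσσ σ τ) (Uτ σ τ) (Uττ σ τ)
    (W σ τ) (Wσ σ τ) (Wσσ σ τ) (Wτ σ τ) (Wττ σ τ)
  rw [eU σ τ hτ, eW σ τ hτ] at h
  linear_combination h

theorem BC.total_integral {bc : BC} {f : Side → ℝ → ℂ}
    (hf : ∀ a ∈ bc.sides, Integrable (f a)) :
    bc.total (fun a => ∫ x, f a x) = ∫ x, bc.total fun a => f a x := by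
  cases bc with
  | transmission κ => exact (integral_add (hf _ trivial) (hf _ trivial)).symm
  | _ => rfl

/-! ### The leading terms of a formal eigenpair -/

section Leading

variable {bc : BC} {G : Set Plane} {x₀ : Plane} {F : BoundaryFrame bc G x₀} {V : Plane → ℝ}
  {lam : ℕ → ℂ} {u : ℕ → Side → ℝ → ℝ → ℂ}

theorem iteratedDeriv_two_schwartz {f : ℝ → ℂ} {φ : 𝓢(ℝ, ℂ)} (h : ∀ x, f x = φ x) (x : ℝ) :
    iteratedDeriv 2 f x = schwartzD (schwartzD φ) x := by
  rw [funext h, iteratedDeriv_succ, iteratedDeriv_one]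
  rfl

/-- The leading term is a product of an eigenfunction of the complex harmonic oscillator and an
eigenfunction of the complex Airy operator. -/
theorem IsFormalExpansion.leading (hexp : IsFormalExpansion F V lam u)
    (hs : IsSimpleAiryEigenvalue bc (F.v V 0 1) (lam 0)) :
    ∃ (φ : 𝓢(ℝ, ℂ)) (g : Side → 𝓢(ℝ, ℂ)), (∃ x, φ x ≠ 0) ∧
      (∃ a ∈ bc.sides, ∃ τ ∈ a.ray, g a τ ≠ 0) ∧
      AirySolution bc (F.v V 0 1) (lam 0) g 0 ∧
      (∀ a ∈ bc.sides, ∀ σ, ∀ τ ∈ a.ray, u 0 a σ τ = φ σ * g a τ) ∧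
      ∀ x : ℝ, schwartzD (schwartzD φ) x = (Complex.I * F.v V 2 0 * x ^ 2 - lam 2) * φ x := by
  have hslice : ∀ j σ a, a ∈ bc.sides → ∃ ψ : 𝓢(ℝ, ℂ), ∀ τ, u j a σ τ = ψ τ :=
    fun j σ a ha => tensorSchwartz_slice_right (hexp.mem j a ha) σ
  choose! s hs' using hslice
  have hbd (j : ℕ) (σ : ℝ) : bc.Holds (fun a => s j σ a 0) (fun a => schwartzD (s j σ a) 0) :=
    (hexp.boundary j σ).congr (fun a ha => hs' j σ a ha 0) fun a ha => by
      rw [funext (hs' j σ a ha), deriv_schwartz]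
  have hL (j : ℕ) (σ : ℝ) (a : Side) (ha : a ∈ bc.sides) (τ : ℝ) :
      F.L V 0 (u j a) σ τ = -schwartzD (schwartzD (s j σ a)) τ
        + Complex.I * F.v V 0 1 * τ * s j σ a τ := by
    rw [F.L_zero, iteratedDeriv_two_schwartz (hs' j σ a ha), hs' j σ a ha]
  have sol (σ : ℝ) : AirySolution bc (F.v V 0 1) (lam 0) (s 0 σ) 0 := by
    refine ⟨fun a ha τ hτ => ?_, hbd 0 σ⟩
    have := hexp.equation 0 a ha σ τ hτ
    simp only [Finset.Nat.sum_antidiagonal_eq_sum_range_succ_mk, Finset.sum_range_succ,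
      Finset.sum_range_zero, zero_add, Nat.sub_self] at this
    rw [hL 0 σ a ha, hs' 0 σ a ha] at this
    simp only [Pi.zero_apply, add_zero]
    linear_combination this
  obtain ⟨a₀, ha₀, σ₀, τ₀, hτ₀, h0⟩ := hexp.ne_zero
  have hne : ∃ a ∈ bc.sides, ∃ τ ∈ a.ray, s 0 σ₀ a τ ≠ 0 :=
    ⟨a₀, ha₀, τ₀, hτ₀, by rwa [← hs' 0 σ₀ a₀ ha₀]⟩
  have hg0 : s 0 σ₀ a₀ τ₀ ≠ 0 := by rwa [← hs' 0 σ₀ a₀ ha₀]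
  obtain ⟨χ, hχ⟩ := tensorSchwartz_slice_left (hexp.mem 0 a₀ ha₀) τ₀
  -- All slices of u₀ lie in a one-dimensional eigenspace. The proportionality factor is read off at
  -- (a₀, τ₀), where the reference slice is nonzero, and so is a Schwartz function of σ.
  have hprod : ∀ a ∈ bc.sides, ∀ σ, ∀ τ ∈ a.ray,
      u 0 a σ τ = ((s 0 σ₀ a₀ τ₀)⁻¹ • χ) σ * s 0 σ₀ a τ := by
    intro a ha σ τ hτ
    obtain ⟨z, hz⟩ := AirySolution.eq_const_mul hs (sol σ₀) hne (sol σ)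
    rw [hs' 0 σ a ha, hz a ha τ hτ, smul_apply, ← hχ, hs' 0 σ a₀ ha₀, hz a₀ ha₀ τ₀ hτ₀,
      smul_eq_mul]
    field_simp
  set φ : 𝓢(ℝ, ℂ) := (s 0 σ₀ a₀ τ₀)⁻¹ • χ with hφ
  clear_value φ
  refine ⟨φ, s 0 σ₀, ⟨σ₀, fun h => h0 ?_⟩, hne, sol σ₀, hprod, ?_⟩
  · rw [hprod a₀ ha₀ σ₀ τ₀ hτ₀, h, zero_mul]
  -- As 𝓛₁ = 0, order 1 reads (𝓛₀ - λ₀) u₁ = λ₁ u₀, and there is no Jordan block.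
  have hlam : lam 1 = 0 := by
    refine AirySolution.eq_zero_of_chain hs (sol σ₀) hne (f := s 1 σ₀)
      ⟨fun a ha τ hτ => ?_, hbd 1 σ₀⟩
    have := hexp.equation 1 a ha σ₀ τ hτ
    simp only [Finset.Nat.sum_antidiagonal_eq_sum_range_succ_mk, Finset.sum_range_succ,
      Finset.sum_range_zero, zero_add, Nat.sub_self, Nat.sub_zero] at this
    rw [hL 1 σ₀ a ha, hs' 1 σ₀ a ha, F.L_one, hs' 0 σ₀ a ha] at this
    linear_combination this
  intro σ
  -- For fixed σ, order 2 has a multiple of g as its source. This multiple must vanish, which is the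
  -- oscillator equation for φ.
  have hc := AirySolution.eq_zero_of_chain hs (sol σ₀) hne (f := s 2 σ)
    (c := schwartzD (schwartzD φ) σ - (Complex.I * F.v V 2 0 * σ ^ 2 - lam 2) * φ σ)
    ⟨fun a ha τ hτ => ?_, hbd 2 σ⟩
  · linear_combination hc
  have := hexp.equation 2 a ha σ τ hτ
  simp only [Finset.Nat.sum_antidiagonal_eq_sum_range_succ_mk, Finset.sum_range_succ,
    Finset.sum_range_zero, zero_add, Nat.sub_self, Nat.sub_zero, Nat.reduceSub] at this
  have hd : iteratedDeriv 2 (fun x => u 0 a x τ) σ = schwartzD (schwartzD φ) σ * s 0 σ₀ a τ := by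
    rw [iteratedDeriv_two_schwartz (φ := s 0 σ₀ a τ • φ) fun x => by
      rw [hprod a ha x τ hτ, smul_apply, smul_eq_mul, mul_comm]]
    simp [mul_comm]
  rw [hL 2 σ a ha, hs' 2 σ a ha, F.L_one, F.L_two, hd, hlam, hprod a ha σ τ hτ] at this
  linear_combination this

end Leading

/-! ### Formal eigenpairs as power series, and evenness of the eigenvalue -/

theorem exists_derivs_of_mem_tensorSchwartz {f : ℝ → ℝ → ℂ} (hf : f ∈ tensorSchwartz) :
    ∃ fσ fσσ fτ fττ : ℝ → ℝ → ℂ, fσ ∈ tensorSchwartz ∧ fτ ∈ tensorSchwartz ∧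
      (∀ σ τ, HasDerivAt (fun s => f s τ) (fσ σ τ) σ) ∧
      (∀ σ τ, HasDerivAt (fun s => fσ s τ) (fσσ σ τ) σ) ∧
      (∀ σ τ, HasDerivAt (fun t => f σ t) (fτ σ τ) τ) ∧
      ∀ σ τ, HasDerivAt (fun t => fτ σ t) (fττ σ τ) τ := by
  obtain ⟨fσ, h1, h2⟩ := tensorSchwartz_hasDerivAt_left hf
  obtain ⟨fσσ, -, h3⟩ := tensorSchwartz_hasDerivAt_left h1
  obtain ⟨fτ, h4, h5⟩ := tensorSchwartz_hasDerivAt_right hf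
  obtain ⟨fττ, -, h6⟩ := tensorSchwartz_hasDerivAt_right h4
  exact ⟨fσ, fσσ, fτ, fττ, h1, h4, h2, h3, h5, h6⟩

/-- A formal eigenpair as a jet of formal series on each side. -/
theorem IsFormalExpansion.exists_jet {bc : BC} {G : Set Plane} {x₀ : Plane}
    {F : BoundaryFrame bc G x₀} {V : Plane → ℝ} {lam : ℕ → ℂ} {u : ℕ → Side → ℝ → ℝ → ℂ}
    (hexp : IsFormalExpansion F V lam u) :
    ∃ Uσ Uσσ Uτ Uττ : Side → ℝ → ℝ → PowerSeries ℂ, ∀ a ∈ bc.sides,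
      SeriesJet (fun σ τ => PowerSeries.mk fun j => u j a σ τ) (Uσ a) (Uσσ a) (Uτ a) (Uττ a) ∧
      ∀ σ, ∀ τ ∈ a.ray, F.opJet V σ τ (PowerSeries.mk fun j => u j a σ τ) (Uσ a σ τ) (Uσσ a σ τ)
        (Uτ a σ τ) (Uττ a σ τ) = PowerSeries.mk lam * PowerSeries.mk fun j => u j a σ τ := by
  have h := fun j a ha => exists_derivs_of_mem_tensorSchwartz (hexp.mem j a ha)
  choose! uσ uσσ uτ uττ mσ mτ dσ dσσ dτ dττ using h
  refine ⟨fun a σ τ => PowerSeries.mk fun j => uσ j a σ τ,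
    fun a σ τ => PowerSeries.mk fun j => uσσ j a σ τ,
    fun a σ τ => PowerSeries.mk fun j => uτ j a σ τ,
    fun a σ τ => PowerSeries.mk fun j => uττ j a σ τ, fun a ha => ⟨⟨?_, ?_, ?_, ?_, ?_, ?_, ?_⟩,
    fun σ τ hτ => ?_⟩⟩
  · intro n; simpa only [coeff_mk] using hexp.mem n a ha
  · intro n; simpa only [coeff_mk] using mσ n a ha
  · intro n; simpa only [coeff_mk] using mτ n a ha
  · intro σ τ n; simpa only [coeff_mk] using dσ n a ha σ τ
  · intro σ τ n; simpa only [coeff_mk] using dσσ n a ha σ τ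
  · intro σ τ n; simpa only [coeff_mk] using dτ n a ha σ τ
  · intro σ τ n; simpa only [coeff_mk] using dττ n a ha σ τ
  · ext n
    have e := hexp.equation n a ha σ τ hτ
    rw [Finset.sum_sub_distrib, sub_eq_zero] at e
    rw [F.coeff_opJet_mk, coeff_mul]
    simp only [coeff_mk]
    rw [← e]
    refine Finset.sum_congr rfl fun p _ => ?_
    rw [← F.opSeries_eq_opJet V (dσ p.2 a ha) (dσσ p.2 a ha) (dτ p.2 a ha) (dττ p.2 a ha)]
    rfl

/-- The bilinear pairing of the leading term with its reflection is not zero. -/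
theorem IsFormalExpansion.total_integral_ne_zero {bc : BC} {G : Set Plane} {x₀ : Plane}
    {F : BoundaryFrame bc G x₀} {V : Plane → ℝ} {lam : ℕ → ℂ} {u : ℕ → Side → ℝ → ℝ → ℂ}
    (hexp : IsFormalExpansion F V lam u) (hs : IsSimpleAiryEigenvalue bc (F.v V 0 1) (lam 0))
    (hv01 : F.v V 0 1 ≠ 0) (hv20 : F.v V 2 0 ≠ 0) :
    bc.total (fun a => a.integral fun σ τ => u 0 a σ τ * u 0 a (-σ) τ) ≠ 0 := by
  obtain ⟨φ, g, hφ, hne, hg, hu, hode⟩ := hexp.leading hs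
  have h1 : bc.total (fun a => a.integral fun σ τ => u 0 a σ τ * u 0 a (-σ) τ)
      = bc.total ((∫ σ, φ σ * φ (-σ)) • fun a => ∫ τ in a.ray, g a τ ^ 2) := by
    refine BC.total_congr fun a ha => ?_
    rw [Side.integral_congr (g := fun σ τ => φ σ * φ (-σ) * g a τ ^ 2) fun σ τ hτ => by
      rw [hu a ha σ τ hτ, hu a ha (-σ) τ hτ]; ring]
    simp only [Side.integral, MeasureTheory.integral_mul_const, MeasureTheory.integral_const_mul,
      Pi.smul_apply, smul_eq_mul]
  rw [h1, LinearMap.map_smul]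
  exact smul_ne_zero (integral_mul_reflect_ne_zero hv20 hode hφ)
    (AirySolution.total_integral_sq_ne_zero hs hg hne hv01)

/-- The eigenvalue series is even. -/
theorem IsFormalExpansion.rescale_eigenvalue {bc : BC} {G : Set Plane} {x₀ : Plane}
    {F : BoundaryFrame bc G x₀} {V : Plane → ℝ} {lam : ℕ → ℂ} {u : ℕ → Side → ℝ → ℝ → ℂ}
    (hexp : IsFormalExpansion F V lam u) (hs : IsSimpleAiryEigenvalue bc (F.v V 0 1) (lam 0))
    (hv01 : F.v V 0 1 ≠ 0) (hv20 : F.v V 2 0 ≠ 0) :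
    PowerSeries.rescale (-1) (PowerSeries.mk lam) = PowerSeries.mk lam := by
  obtain ⟨Uσ, Uσσ, Uτ, Uττ, hJ⟩ := hexp.exists_jet
  set U : Side → ℝ → ℝ → PowerSeries ℂ := fun a σ τ => PowerSeries.mk fun j => u j a σ τ with hU
  set W : Side → ℝ → ℝ → PowerSeries ℂ :=
    fun a σ τ => PowerSeries.rescale (-1) (U a (-σ) τ) with hW
  set Wτ : Side → ℝ → ℝ → PowerSeries ℂ :=
    fun a σ τ => PowerSeries.rescale (-1) (Uτ a (-σ) τ) with hWτ
  set D := PowerSeries.mk lam - PowerSeries.rescale (-1) (PowerSeries.mk lam) with hD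
  have hgreen (n : ℕ) (a : Side) (ha : a ∈ bc.sides) :
      ∑ p ∈ Finset.HasAntidiagonal.antidiagonal n, coeff p.1 D
        * a.integral (fun σ τ => coeff p.2 (F.aSeries σ τ * (U a σ τ * W a σ τ)))
      = -(a.sign * ∫ σ, coeff n (W a σ 0 * Uτ a σ 0 - U a σ 0 * Wτ a σ 0)) := by
    refine F.green V a (hJ a ha).1 (hJ a ha).1.reflect (hJ a ha).2 (fun σ τ hτ => ?_) n
    have h := congrArg (PowerSeries.rescale (-1 : ℂ)) ((hJ a ha).2 (-σ) τ hτ)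
    rwa [F.rescale_opJet, map_mul] at h
  have hbd (σ : ℝ) (n : ℕ) :
      bc.total (fun a => a.sign * coeff n (W a σ 0 * Uτ a σ 0 - U a σ 0 * Wτ a σ 0)) = 0 := by
    have hder (j : ℕ) (s : ℝ) :
        bc.Holds (fun a => u j a s 0) (fun a => coeff j (Uτ a s 0)) :=
      (hexp.boundary j s).congr (fun _ _ => rfl) fun a ha => by
        have := (hJ a ha).1.derivτ s 0 j
        simp only [coeff_mk] at this
        exact this.deriv
    have hder' (j : ℕ) : bc.Holds (fun a => coeff j (W a σ 0)) (fun a => coeff j (Wτ a σ 0)) := by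
      simpa only [hW, hWτ, hU, coeff_rescale, coeff_mk] using (hder j (-σ)).const_mul ((-1) ^ j)
    -- Each coefficient of the Wronskian is a sum of Wronskians of pairs of coefficients, and every
    -- such coefficient satisfies the boundary condition because κ does not depend on `X`.
    have he : (fun a => a.sign * coeff n (W a σ 0 * Uτ a σ 0 - U a σ 0 * Wτ a σ 0))
        = ∑ p ∈ Finset.HasAntidiagonal.antidiagonal n, fun a : Side =>
          a.sign * (coeff p.1 (W a σ 0) * coeff p.2 (Uτ a σ 0)
            - u p.2 a σ 0 * coeff p.1 (Wτ a σ 0)) := by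
      ext a
      rw [map_sub, mul_comm (U a σ 0), coeff_mul, coeff_mul, ← Finset.sum_sub_distrib,
        Finset.mul_sum, Finset.sum_apply]
      simp only [hU, coeff_mk, mul_comm]
    rw [he, map_sum]
    exact Finset.sum_eq_zero fun p _ => (hder p.2 σ).wronskian (hder' p.1)
  have hprod : D * PowerSeries.mk (fun n => bc.total fun a =>
      a.integral fun σ τ => coeff n (F.aSeries σ τ * (U a σ τ * W a σ τ))) = 0 := by
    ext n
    rw [coeff_mul, map_zero]
    simp only [coeff_mk, ← smul_eq_mul (α := ℂ), ← LinearMap.map_smul, ← map_sum]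
    rw [BC.total_congr (y := -fun a =>
      ∫ σ, a.sign * coeff n (W a σ 0 * Uτ a σ 0 - U a σ 0 * Wτ a σ 0)) fun a ha => by
        rw [Finset.sum_apply, Pi.neg_apply, MeasureTheory.integral_const_mul]
        exact hgreen n a ha]
    rw [map_neg, BC.total_integral fun a ha => ?_]
    · simp only [hbd, integral_zero, neg_zero]
    · have hj := (hJ a ha).1
      exact (tensorSchwartz_integrable (((hj.mem.reflect.mul hj.memτ).sub
        (hj.mem.mul hj.memτ.reflect)) n) 0).const_mul _
  have hne : PowerSeries.mk (fun n => bc.total fun a =>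
      a.integral fun σ τ => coeff n (F.aSeries σ τ * (U a σ τ * W a σ τ))) ≠ 0 := by
    intro h
    refine hexp.total_integral_ne_zero hs hv01 hv20 ?_
    have h0 := congrArg (coeff 0) h
    -- At order 0 the Jacobian is 1 and the rescaling acts trivially, which leaves the pairing of u₀
    -- with its reflection in σ.
    simpa [hU, hW, F.constantCoeff_aSeries, rescale_mk] using h0
  have := (mul_eq_zero.1 hprod).resolve_right hne
  exact (sub_eq_zero.1 this).symm

end BlochTorrey

end

theorem mainTheorem3 (bc : BlochTorrey.BC) (Ω G : Set BlochTorrey.Plane)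
    (hΩ : IsOpen Ω) (hG : IsOpen G) (hΩG : bc.Compatible Ω G)
    (V : BlochTorrey.Plane → ℝ) (hV : ContDiffOn ℝ ∞ V (closure Ω))
    (x₀ : BlochTorrey.Plane) (F : BlochTorrey.BoundaryFrame bc G x₀)
    (hv10 : F.v V 1 0 = 0) (hv01 : F.v V 0 1 ≠ 0) (hv20 : F.v V 2 0 ≠ 0)
    (lam : ℕ → ℂ) (u : ℕ → BlochTorrey.Side → ℝ → ℝ → ℂ)
    (hsimple : BlochTorrey.IsSimpleAiryEigenvalue bc (F.v V 0 1) (lam 0))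
    (hexp : BlochTorrey.IsFormalExpansion F V lam u)
    (j : ℕ) (hj : Odd j) : lam j = 0 := by
  have h := congrArg (PowerSeries.coeff j) (hexp.rescale_eigenvalue hsimple hv01 hv20)
  rw [PowerSeries.coeff_rescale, PowerSeries.coeff_mk, hj.neg_one_pow, neg_one_mul] at h
  exact self_eq_neg.1 h.symm
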